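/- Let $d_1,\dots,d_n$ be primes, $\mathbf d=(d_1,\dots,d_n)$ and $\mathcal H=\bigotimes_{i=1}^n\mathbb C^{d_i}$. Party $i$ has $m_i$ measurement settings, each with outcomes in $\mathbb F_{d_i}$, and a Bell expression is given by real coefficients $I^{\mathbf a}_{\mathbf x}$, where $\mathbf a\in\prod_i\mathbb F_{d_i}$ and $\mathbf x\in\prod_i\{0,\dots,m_i-1\}$. Put $$\tilde I^{\mathbf k}_{\mathbf x}=\frac1{\prod_i d_i}\sum_{\mathbf a}\exp\Big[2\pi i\sum_{j=1}^n\frac{k_ja_j}{d_j}\Big]I^{\mathbf a}_{\mathbf x}.$$ *Stabilizer states.* On $\mathbb C^{d}$, $d$ prime, let $X|a\rangle=|a+1\rangle$ and $Z|a\rangle=e^{2\pi i a/d}|a\rangle$. The one-qudit Pauli group consists of the operators $cX^aZ^b$ with $c^d=1$ if $d$ is odd and $c^4=1$ if $d=2$; the Pauli group of $\mathcal H$ consists of the tensor products of one-qudit Pauli operators. A stabilizer group is an abelian subgroup $\mathcal S$ of the Pauli group that contains no scalar other than $1$ and has $|\mathcal S|=\prod_i d_i$. $\mathrm{STAB}_{\mathbf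 d}$ is the set of unit vectors of $\mathcal H$ fixed by all elements of some stabilizer group. *Graph states.* Let $[\mathbf d]$ be the set of distinct values among $d_1,\dots,d_n$, and for $p\in[\mathbf d]$ let $V_p=\{i: d_i=p\}$. An adjacency matrix on $V_p$ is a symmetric matrix over $\mathbb F_p$ with zero diagonal and rows and columns indexed by $V_p$. Consider the moves $\mathrm M_{b,v}A=I_{v,b}AI_{v,b}$, where $b\in\mathbb F_p\setminus\{0\}$ and $I_{v,b}=\mathrm{diag}(1,\dots,b,\dots,1)$ has $b$ at position $v$, and $(\mathrm L_{a,v}A)_{ij}=A_{ij}+aA_{vi}A_{vj}$ for $i\ne j$, $(\mathrm L_{a,v}A)_{jj}=0$, where $a\in\mathbb F_p$. Let $[A_{V_p}]_{\mathrm M,\mathrm L}$ be the set of equivalence classes of adjacency matrices on $V_p$ modulo these moves. For a direct sum $A=\bigoplus_{p\in[\mathbf d]}A_p$ of adjacency matrices $A_p$ on $V_p$ (so $A_{ij}=0$ if $d_i\ne d_j$) let $$|G(A)\rangle=\prod_{i<j}\mathrm{CP}_{ij}^{A_{ij}}\bigotimes_{i=1}^n|+\rangle_i,\qquad \mathrm{CP}_{ij}=\sum_a|a\rangle\langle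 a|_i\otimes Z_j^a,\qquad |+\rangle_i=d_i^{-1/2}\sum_a|a\rangle.$$ **Theorem.** Let $I_{\mathrm{STAB}}(\mathcal H,\mathbf d)$ be the maximum of $\sum_{\mathbf a,\mathbf x}I^{\mathbf a}_{\mathbf x}\langle\psi|\bigotimes_iM^{(i)}_{a_i|x_i}|\psi\rangle$ over all $\psi\in\mathrm{STAB}_{\mathbf d}$ and all projective measurements (orthogonal projectors with $M^{(i)}_{a|x}M^{(i)}_{a'|x}=\delta_{a,a'}M^{(i)}_{a|x}$ and $\sum_aM^{(i)}_{a|x}=1$). This maximum exists; it is also the maximum of $\sum_{\mathbf k,\mathbf x}\tilde I^{\mathbf k}_{\mathbf x}\langle\psi|\bigotimes_i(U_i^{x_i})^{k_i}|\psi\rangle$ over all $\psi\in\mathrm{STAB}_{\mathbf d}$ and all $U_i^{x}\in\mathbb C^{d_i\times d_i}$ with $U_i^{x\dagger}U_i^{x}=1$ and $(U_i^{x})^{d_i}=1$; and, for every choice of one representative in each class of $[A_{V_p}]_{\mathrm M,\mathrm L}$, $p\in[\mathbf d]$, $$I_{\mathrm{STAB}}(\mathcal H,\mathbf d)=\max_{A}\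 \max_{U}\ \sum_{\mathbf k,\mathbf x}\tilde I^{\mathbf k}_{\mathbf x}\,\langle G(A)|\bigotimes_{i=1}^n(U_i^{x_i})^{k_i}|G(A)\rangle ,$$ where $A$ runs over the direct sums $\bigoplus_{p\in[\mathbf d]}A_p$ of chosen representatives and $U$ over the families $(U_i^x)$ as above. All these values are real and all the maxima are attained. -/

import Mathlib

open scoped BigOperators

noncomputable section

namespace StabScenario

/-! ### One qudit -/

/-- The shift operator `X = ∑ a, |a + 1⟩⟨a|` on `ℂ^p`, with basis indexed by `ZMod p`. -/
def pauliX (p : ℕ) [NeZero p] : Matrix (ZMod p) (ZMod p) ℂ :=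
  Matrix.of fun i j => if i = j + 1 then 1 else 0

/-- The clock operator `Z = ∑ a, ω ^ a |a⟩⟨a|`, where `ω = exp (2 π i / p)`
(`ZMod.stdAddChar a` is `ω ^ a`). -/
def pauliZ (p : ℕ) [NeZero p] : Matrix (ZMod p) (ZMod p) ℂ :=
  Matrix.diagonal fun a => ZMod.stdAddChar a

/-- The one-qudit Pauli group of prime dimension `p`: the operators `c X^a Z^b` with `c` a `p`-th
root of unity, and, for `p = 2`, with `c ∈ {1, -1, i, -i}`. This is the group generated by the
displacement operators `ω ^ (a b / 2) X^a Z^b`. -/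
def localPauli (p : ℕ) [NeZero p] : Set (Matrix (ZMod p) (ZMod p) ℂ) :=
  {P | ∃ (c : ℂ) (a b : ZMod p), c ^ (if p = 2 then 4 else p) = 1 ∧
    P = c • (pauliX p ^ a.val * pauliZ p ^ b.val)}

/-! ### `n` qudits of dimensions `d 0, …, d (n - 1)` -/

variable {n : ℕ}

/-- Labels of the computational basis of `⨂ i, ℂ^(d i)`. Vectors of this space are functions
`Conf d → ℂ`, operators are matrices indexed by `Conf d`. -/
abbrev Conf (d : Fin n → ℕ) : Type := ∀ i, ZMod (d i)

/-- The tensor product `⨂ i, M i` of local operators. -/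
def tensorOp {d : Fin n → ℕ} (M : ∀ i, Matrix (ZMod (d i)) (ZMod (d i)) ℂ) :
    Matrix (Conf d) (Conf d) ℂ :=
  Matrix.of fun s t => ∏ i, M i (s i) (t i)

variable (d : Fin n → ℕ) [∀ i, NeZero (d i)]

/-- The expectation value `⟨ψ|M|ψ⟩`. -/
def expect (M : Matrix (Conf d) (Conf d) ℂ) (ψ : Conf d → ℂ) : ℂ :=
  star ψ ⬝ᵥ (M.mulVec ψ)

/-- The `n`-qudit Pauli group: tensor products of one-qudit Pauli operators. -/
def pauliGroup : Set (Matrix (Conf d) (Conf d) ℂ) :=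
  {P | ∃ Q : ∀ i, Matrix (ZMod (d i)) (ZMod (d i)) ℂ,
    (∀ i, Q i ∈ localPauli (d i)) ∧ P = tensorOp Q}

/-- Stabilizer groups: abelian groups of Pauli operators that contain no scalar besides the
identity and are maximal, `|S| = ∏ i, d i = dim H` (`n` independent generators, one of order `d i`
for every qudit `i`). -/
structure IsStabilizerGroup (S : Subgroup (Matrix.unitaryGroup (Conf d) ℂ)) : Prop where
  pauli : ∀ s ∈ S, (s : Matrix (Conf d) (Conf d) ℂ) ∈ pauliGroup d
  comm : ∀ s ∈ S, ∀ t ∈ S, s * t = t * s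
  no_scalar : ∀ s ∈ S, ∀ c : ℂ, (s : Matrix (Conf d) (Conf d) ℂ) = c • 1 → c = 1
  card_eq : Nat.card S = ∏ i, d i

/-- `STAB_d`: the unit vectors fixed by every element of some stabilizer group. -/
def stabStates : Set (Conf d → ℂ) :=
  {ψ | star ψ ⬝ᵥ ψ = 1 ∧ ∃ S : Subgroup (Matrix.unitaryGroup (Conf d) ℂ),
    IsStabilizerGroup d S ∧
      ∀ s ∈ S, (s : Matrix (Conf d) (Conf d) ℂ).mulVec ψ = ψ}

/-! ### Bell expressions -/

variable {d} {m : Fin n → ℕ}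

/-- Projective measurements: for each party `i` and setting `x < m i`, orthogonal projectors
`M i x a`, `a ∈ ZMod (d i)`, that are mutually orthogonal and add up to the identity. -/
structure IsMeasurement
    (M : ∀ i, Fin (m i) → ZMod (d i) → Matrix (ZMod (d i)) (ZMod (d i)) ℂ) : Prop where
  herm : ∀ i x a, (M i x a).IsHermitian
  mul_eq : ∀ i x a a', M i x a * M i x a' = if a' = a then M i x a else 0
  sum_eq : ∀ i x, ∑ a, M i x a = 1

/-- The Bell expression `∑ I^a_x p(a|x)` with `p(a|x) = ⟨ψ| ⨂ i, M i (x i) (a i) |ψ⟩`. -/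
def bellMeas (I : Conf d → (∀ i, Fin (m i)) → ℝ)
    (M : ∀ i, Fin (m i) → ZMod (d i) → Matrix (ZMod (d i)) (ZMod (d i)) ℂ)
    (ψ : Conf d → ℂ) : ℂ :=
  ∑ a : Conf d, ∑ x : (∀ i, Fin (m i)),
    (I a x : ℂ) * expect d (tensorOp fun i => M i (x i) (a i)) ψ

/-- The local observables: unitaries `U i x` with `(U i x) ^ (d i) = 1`. -/
structure IsObservable
    (U : ∀ i, Fin (m i) → Matrix (ZMod (d i)) (ZMod (d i)) ℂ) : Prop where
  unitary : ∀ i x, (U i x).conjTranspose * U i x = 1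
  pow_eq : ∀ i x, U i x ^ d i = 1

/-- The Fourier transform
`Ĩ^k_x = (∏ i, d i)⁻¹ ∑ a, exp (2 π i ∑ j, k_j a_j / d_j) I^a_x` of the coefficients. -/
def fourierCoeff (I : Conf d → (∀ i, Fin (m i)) → ℝ) (k : Conf d) (x : ∀ i, Fin (m i)) : ℂ :=
  (∏ i, (d i : ℂ))⁻¹ * ∑ a : Conf d, (∏ j, ZMod.stdAddChar (k j * a j)) * (I a x : ℂ)

/-- `∑ Ĩ^k_x ⟨ψ| ⨂ i, (U i (x i)) ^ (k i) |ψ⟩`. -/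
def bellUnitary (I : Conf d → (∀ i, Fin (m i)) → ℝ)
    (U : ∀ i, Fin (m i) → Matrix (ZMod (d i)) (ZMod (d i)) ℂ) (ψ : Conf d → ℂ) : ℂ :=
  ∑ k : Conf d, ∑ x : (∀ i, Fin (m i)),
    fourierCoeff I k x * expect d (tensorOp fun i => U i (x i) ^ (k i).val) ψ

/-- `v` is the maximum of the set `V` of complex numbers, all of which are real. -/
def IsMaxValue (V : Set ℂ) (v : ℝ) : Prop :=
  (v : ℂ) ∈ V ∧ ∀ z ∈ V, z.im = 0 ∧ z.re ≤ v

/-! ### Adjacency matrices and their orbits -/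

/-- Symmetric matrices over `ZMod p` with zero diagonal, with rows and columns indexed by `ι`. -/
abbrev Adj (ι : Type) (p : ℕ) : Type :=
  {A : Matrix ι ι (ZMod p) // A.IsSymm ∧ ∀ i, A i i = 0}

/-- The move `M_{b,v}`: `A ↦ I_{v,b} A I_{v,b}` with `I_{v,b} = diag (1, …, b, …, 1)`. -/
def moveM {ι : Type} [Fintype ι] [DecidableEq ι] {p : ℕ} (b : ZMod p) (v : ι)
    (A : Matrix ι ι (ZMod p)) : Matrix ι ι (ZMod p) :=
  Matrix.diagonal (Function.update 1 v b) * A * Matrix.diagonal (Function.update 1 v b)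

/-- The move `L_{a,v}`: `A i j ↦ A i j + a A v i A v j` off the diagonal, `0` on it. -/
def moveL {ι : Type} [DecidableEq ι] {p : ℕ} (a : ZMod p) (v : ι)
    (A : Matrix ι ι (ZMod p)) : Matrix ι ι (ZMod p) :=
  Matrix.of fun i j => if i = j then 0 else A i j + a * A v i * A v j

/-- `B` arises from `A` by one move. -/
def Step {ι : Type} [Fintype ι] [DecidableEq ι] {p : ℕ} (A B : Adj ι p) : Prop :=
  (∃ (b : ZMod p) (v : ι), b ≠ 0 ∧ B.1 = moveM b v A.1) ∨
    (∃ (a : ZMod p) (v : ι), B.1 = moveL a v A.1)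

/-- The equivalence relation generated by the moves `M` and `L`. -/
def orbitSetoid (ι : Type) [Fintype ι] [DecidableEq ι] (p : ℕ) : Setoid (Adj ι p) :=
  Relation.EqvGen.setoid Step

/-- The set of equivalence classes of adjacency matrices modulo the moves. -/
abbrev Orbit (ι : Type) [Fintype ι] [DecidableEq ι] (p : ℕ) : Type :=
  Quotient (orbitSetoid ι p)

variable (d)

/-- The qudits of dimension `p`. -/
abbrev Block (p : ℕ) : Type := {i : Fin n // d i = p}

/-- One adjacency matrix over `ZMod p`, on the qudits of dimension `p`, for every distinct
dimension `p`. -/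
abbrev BlockAdj : Type := ∀ p : Set.range d, Adj (Block d p) p

/-- A choice of one representative in every orbit of adjacency matrices, for every distinct
dimension `p`. -/
abbrev RepChoice : Type :=
  {rep : (∀ p : Set.range d, Orbit (Block d p) p → Adj (Block d p) p) //
    ∀ (p : Set.range d) (q : Orbit (Block d p) p),
      (Quotient.mk (orbitSetoid (Block d p) p) (rep p q)) = q}

variable {d}

/-- The families of blocks all of which are chosen representatives. -/
def repBlocks (rep : RepChoice d) : Set (BlockAdj d) :=
  {A | ∃ q : (∀ p : Set.range d, Orbit (Block d p) p), A = fun p => rep.1 p (q p)}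

/-- The direct sum of the blocks: the entry `(i, j)` lies in `ZMod (d i)` and vanishes when
`d i ≠ d j`. -/
def directSum (A : BlockAdj d) (i j : Fin n) : ZMod (d i) :=
  if h : d j = d i then (A ⟨d i, i, rfl⟩).1 ⟨i, rfl⟩ ⟨j, h⟩ else 0

/-- The controlled phase gate `∑ a, |a⟩⟨a| ⊗ Z^a` with control `i` and target `j`. -/
def CP (i j : Fin n) : Matrix (Conf d) (Conf d) ℂ :=
  Matrix.diagonal fun s => ZMod.stdAddChar (((s i).val : ZMod (d j)) * s j)

theorem CP_pow_commute (e f : Fin n × Fin n) (k l : ℕ) :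
    Commute ((CP e.1 e.2 : Matrix (Conf d) (Conf d) ℂ) ^ k) (CP f.1 f.2 ^ l) := by
  apply Commute.pow_pow
  simp only [CP, Commute, SemiconjBy, Matrix.diagonal_mul_diagonal, mul_comm]

/-- `⨂ i, |+⟩`, where `|+⟩ = (d i)^(-1/2) ∑ a, |a⟩` is the `+1` eigenvector of `X`. -/
def plusState : Conf d → ℂ := fun _ => ∏ i, ((Real.sqrt (d i) : ℝ) : ℂ)⁻¹

/-- The graph state `|G(A)⟩ = ∏_{i < j} CP_{ij}^{A i j} ⨂ i, |+⟩`, for a matrix with entries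
`A i j` in `ZMod (d i)`. -/
def graphState (A : ∀ i : Fin n, Fin n → ZMod (d i)) : Conf d → ℂ :=
  ((Finset.univ.filter fun e : Fin n × Fin n => e.1 < e.2).noncommProd
    (fun e => (CP e.1 e.2 : Matrix (Conf d) (Conf d) ℂ) ^ (A e.1 e.2).val)
    (fun e _ f _ _ => CP_pow_commute e f _ _)).mulVec plusState

end StabScenario

end

/-!
Measurements and observables of order `d i` correspond to each other by the discrete Fourier
transform (`phaseSum`, `spectralProj`), so the two Bell expressions take the same values, which are
real because expectation values of projectors are. For a fixed state the observables form a compact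
set, so a maximum exists, and it depends only on the local unitary class of the state
(`bellUnitary_of_luEquiv`). It remains to show that the stabilizer states are, up to local
unitaries, exactly the graph states, and that the moves `M` and `L` do not leave the class.

Both facts are read off from the group `labels ψ` of those `(a, b)` for which `ψ` is an eigenvector
of the Weyl operator `X^(-a) Z^b`; phases of Pauli operators can be ignored. This group is isotropic
(`labels_isotropic`), and for a stabilizer state it has at least `∏ i, d i` elements. If at each
site either the axis of `X` or that of `Z` is picked greedily, isotropy ensures that the group meets
the span of the chosen axes trivially; after Fourier transforms at the sites with axis `X` it meets
`{(0, b)}` trivially (`exists_transverse`), and by counting it contains some `(e_i, b_i)` for each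
`i`. Isotropy then says that the `b_i` form a symmetric matrix; entries between different primes
vanish, because a root of unity of two coprime orders is `1`. Dividing `ψ` by the amplitudes of the
graph state of that matrix leaves a function whose translate along each axis differs from it by a
phase in that coordinate alone, hence a product of local phases (`exists_prod_of_translate`). This
is the criterion `luEquiv_graphState`.

The same criterion handles the moves: `M` is a permutation of the basis at one site, and `L` is the
shear `(a, b) ↦ (a + α b, b)` of labels at one site (`exists_shear`), followed by a change of
generators. Conversely the shifts conjugated by the amplitudes of a graph state form a stabilizer
group (`graphState_mem_stabStates`).
-/

noncomputable section

open ZMod Matrix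

namespace StabScenario

variable {n : ℕ} {d : Fin n → ℕ}

/-! ### Tensor products of local operators -/

section TensorOp

theorem tensorOp_mul [∀ i, NeZero (d i)] (M N : ∀ i, Matrix (ZMod (d i)) (ZMod (d i)) ℂ) :
    tensorOp M * tensorOp N = tensorOp fun i => M i * N i := by
  ext s t
  simp only [tensorOp, mul_apply, of_apply, Finset.prod_univ_sum, Fintype.piFinset_univ,
    Finset.prod_mul_distrib]

theorem tensorOp_conjTranspose (M : ∀ i, Matrix (ZMod (d i)) (ZMod (d i)) ℂ) :
    (tensorOp M)ᴴ = tensorOp fun i => (M i)ᴴ := by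
  ext s t
  simp [tensorOp, conjTranspose_apply]

theorem tensorOp_one :
    tensorOp (fun i => (1 : Matrix (ZMod (d i)) (ZMod (d i)) ℂ)) = 1 := by
  ext s t
  by_cases h : s = t
  · subst h
    simp [tensorOp]
  · obtain ⟨i, hi⟩ := Function.ne_iff.mp h
    rw [one_apply_ne h]
    exact Finset.prod_eq_zero (Finset.mem_univ i) (one_apply_ne hi)

theorem tensorOp_smul (c : Fin n → ℂ) (M : ∀ i, Matrix (ZMod (d i)) (ZMod (d i)) ℂ) :
    tensorOp (fun i => c i • M i) = (∏ i, c i) • tensorOp M := by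
  ext s t
  simp [tensorOp, Finset.prod_mul_distrib]

variable [∀ i, NeZero (d i)]

theorem expect_smul (c : ℂ) (hc : ‖c‖ = 1) (M : Matrix (Conf d) (Conf d) ℂ) (ψ : Conf d → ℂ) :
    expect d M (c • ψ) = expect d M ψ := by
  have h : c * star c = 1 := by
    rw [Complex.star_def, Complex.mul_conj', hc]; simp
  simp only [expect, star_smul, mulVec_smul, smul_dotProduct, dotProduct_smul, smul_eq_mul]
  rw [← mul_assoc, h, one_mul]

theorem expect_mulVec (M N : Matrix (Conf d) (Conf d) ℂ) (ψ : Conf d → ℂ) :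
    expect d M (N *ᵥ ψ) = expect d (Nᴴ * M * N) ψ := by
  simp only [expect, star_mulVec, ← dotProduct_mulVec, mulVec_mulVec, Matrix.mul_assoc]

theorem star_dotProduct_self (ψ : Conf d → ℂ) : star ψ ⬝ᵥ ψ = expect d 1 ψ := by
  simp [expect]

end TensorOp

/-! ### Local unitary equivalence -/

section LU

variable [∀ i, NeZero (d i)]

/-- Local unitary equivalence of vectors: `ψ` is the image of `φ` under a tensor product of
one-qudit unitaries, up to a global phase. The phase is kept separate because for `n = 0` no local unitary
can absorb it. -/
def LUEquiv (ψ φ : Conf d → ℂ) : Prop :=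
  ∃ V : ∀ i, Matrix (ZMod (d i)) (ZMod (d i)) ℂ, (∀ i, (V i)ᴴ * V i = 1) ∧
    ∃ c : ℂ, ‖c‖ = 1 ∧ ψ = c • (tensorOp V *ᵥ φ)

theorem tensorOp_isometry {V : ∀ i, Matrix (ZMod (d i)) (ZMod (d i)) ℂ}
    (hV : ∀ i, (V i)ᴴ * V i = 1) : (tensorOp V)ᴴ * tensorOp V = 1 := by
  rw [tensorOp_conjTranspose, tensorOp_mul]
  simp only [hV, tensorOp_one]

theorem LUEquiv.refl (ψ : Conf d → ℂ) : LUEquiv ψ ψ :=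
  ⟨fun _ => 1, by simp, 1, by simp, by simp [tensorOp_one]⟩

theorem LUEquiv.mulVec {V : ∀ i, Matrix (ZMod (d i)) (ZMod (d i)) ℂ}
    (hV : ∀ i, (V i)ᴴ * V i = 1) (ψ : Conf d → ℂ) : LUEquiv (tensorOp V *ᵥ ψ) ψ :=
  ⟨V, hV, 1, by simp, by simp⟩

theorem LUEquiv.symm {ψ φ : Conf d → ℂ} (h : LUEquiv ψ φ) : LUEquiv φ ψ := by
  obtain ⟨V, hV, c, hc, rfl⟩ := h
  have hc0 : c ≠ 0 := by rintro rfl; simp at hc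
  refine ⟨fun i => (V i)ᴴ, fun i => ?_, c⁻¹, by simp [hc], ?_⟩
  · rw [conjTranspose_conjTranspose]
    exact mul_eq_one_comm.mp (hV i)
  · rw [← tensorOp_conjTranspose, mulVec_smul, mulVec_mulVec, tensorOp_isometry hV, one_mulVec,
      smul_smul, inv_mul_cancel₀ hc0, one_smul]

theorem LUEquiv.trans {ψ φ θ : Conf d → ℂ} (h : LUEquiv ψ φ) (h' : LUEquiv φ θ) :
    LUEquiv ψ θ := by
  obtain ⟨V, hV, c, hc, rfl⟩ := h
  obtain ⟨W, hW, e, he, rfl⟩ := h'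
  refine ⟨fun i => V i * W i, fun i => ?_, c * e, by simp [hc, he], ?_⟩
  · rw [conjTranspose_mul, Matrix.mul_assoc, ← Matrix.mul_assoc _ (V i), hV, Matrix.one_mul, hW]
  · rw [mulVec_smul, mulVec_mulVec, tensorOp_mul, smul_smul]

theorem LUEquiv.unit {ψ φ : Conf d → ℂ} (h : LUEquiv ψ φ) (hφ : star φ ⬝ᵥ φ = 1) :
    star ψ ⬝ᵥ ψ = 1 := by
  obtain ⟨V, hV, c, hc, rfl⟩ := h
  rw [star_dotProduct_self, expect_smul c hc, expect_mulVec, Matrix.mul_one, tensorOp_isometry hV,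
    ← star_dotProduct_self, hφ]

end LU

/-! ### Weyl operators and their joint eigenvectors -/

theorem norm_stdAddChar {p : ℕ} [NeZero p] (x : ZMod p) : ‖(stdAddChar x : ℂ)‖ = 1 := by
  rw [stdAddChar_apply, Circle.norm_coe]

theorem stdAddChar_ne_zero {p : ℕ} [NeZero p] (x : ZMod p) : (stdAddChar x : ℂ) ≠ 0 := by
  rw [stdAddChar_apply]
  exact Circle.coe_ne_zero _

/-- The one-qudit Weyl operator, acting on functions by `f ↦ (s ↦ ω ^ (b s) f (s + a))`; up to a
phase it is `X^(-a) Z^b`. -/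
def weyl {p : ℕ} [NeZero p] (a b : ZMod p) : Matrix (ZMod p) (ZMod p) ℂ :=
  Matrix.of fun s t => if t = s + a then stdAddChar (b * s) else 0

theorem pauliX_pow {p : ℕ} [NeZero p] (k : ℕ) (s t : ZMod p) :
    (pauliX p ^ k) s t = if s = t + k then 1 else 0 := by
  induction k generalizing s with
  | zero => simp [one_apply]
  | succ k ih =>
    rw [pow_succ', mul_apply, Finset.sum_eq_single (s - 1)]
    · rw [ih]
      simp [pauliX, sub_eq_iff_eq_add, add_assoc]
    · intro u _ hu
      have : ¬ s = u + 1 := fun h => hu (by simp [h])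
      simp [pauliX, this]
    · simp

theorem pauliX_pow_mul_pauliZ_pow_apply {p : ℕ} [NeZero p] (a b s t : ZMod p) :
    (pauliX p ^ a.val * pauliZ p ^ b.val) s t =
      if s = t + a then (stdAddChar (b * t) : ℂ) else 0 := by
  rw [pauliZ, diagonal_pow, mul_diagonal, pauliX_pow, natCast_zmod_val, Pi.pow_apply,
    ← AddChar.map_nsmul_eq_pow, nsmul_eq_mul, natCast_zmod_val, ite_mul, one_mul, zero_mul]

theorem pauliX_pow_mul_pauliZ_pow {p : ℕ} [NeZero p] (a b : ZMod p) :
    pauliX p ^ a.val * pauliZ p ^ b.val = (stdAddChar (-(b * a)) : ℂ) • weyl (-a) b := by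
  ext s t
  rw [pauliX_pow_mul_pauliZ_pow_apply, Matrix.smul_apply]
  simp only [weyl, of_apply, smul_eq_mul, ← sub_eq_add_neg, eq_sub_iff_add_eq]
  by_cases h : t + a = s
  · subst h
    rw [if_pos rfl, if_pos rfl, ← AddChar.map_add_eq_mul]
    congr 1
    ring
  · rw [if_neg h, if_neg (fun h' => h h'.symm), mul_zero]

section Labels

variable [∀ i, NeZero (d i)]

/-- The character `∏ i, exp (2 π i b_i t_i / d_i)`. -/
def pairing (b t : Conf d) : ℂ := ∏ i, stdAddChar (b i * t i)

theorem pairing_add_left (b b' t : Conf d) : pairing (b + b') t = pairing b t * pairing b' t := by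
  simp [pairing, add_mul, AddChar.map_add_eq_mul, Finset.prod_mul_distrib]

theorem pairing_add_right (b t t' : Conf d) : pairing b (t + t') = pairing b t * pairing b t' := by
  simp [pairing, mul_add, AddChar.map_add_eq_mul, Finset.prod_mul_distrib]

theorem pairing_zero_left (t : Conf d) : pairing 0 t = 1 := by simp [pairing]

theorem pairing_zero_right (t : Conf d) : pairing t 0 = 1 := by simp [pairing]

theorem norm_pairing (b t : Conf d) : ‖pairing b t‖ = 1 := by
  simp [pairing, norm_prod]

theorem pairing_ne_zero (b t : Conf d) : pairing b t ≠ 0 :=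
  Finset.prod_ne_zero_iff.mpr fun _ _ => stdAddChar_ne_zero _

theorem pairing_neg_left (b t : Conf d) : pairing (-b) t = (pairing b t)⁻¹ := by
  refine eq_inv_of_mul_eq_one_left ?_
  rw [← pairing_add_left, neg_add_cancel,
    pairing_zero_left]

theorem pairing_neg_right (b t : Conf d) : pairing b (-t) = (pairing b t)⁻¹ := by
  refine eq_inv_of_mul_eq_one_left ?_
  rw [← pairing_add_right, neg_add_cancel,
    pairing_zero_right]

theorem pairing_single (b : Conf d) (i : Fin n) (x : ZMod (d i)) :
    pairing b (Pi.single i x) = stdAddChar (b i * x) := by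
  rw [pairing, Finset.prod_eq_single i]
  · simp
  · intro j _ hj
    simp [Pi.single_eq_of_ne hj]
  · simp

theorem tensorOp_weyl_mulVec (a b : Conf d) (ψ : Conf d → ℂ) (t : Conf d) :
    (tensorOp (fun i => weyl (a i) (b i)) *ᵥ ψ) t = pairing b t * ψ (t + a) := by
  rw [mulVec, dotProduct, Finset.sum_eq_single (t + a)]
  · simp [tensorOp, weyl, pairing]
  · intro u _ hu
    obtain ⟨i, hi⟩ := Function.ne_iff.mp hu
    have : tensorOp (fun i => weyl (a i) (b i)) t u = 0 :=
      Finset.prod_eq_zero (Finset.mem_univ i) (by simp only [weyl, of_apply]; exact if_neg hi)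
    rw [this, zero_mul]
  · simp

/-- The group of labels `(a, b)` of those Weyl operators that have `ψ` as an eigenvector. Phases of
Pauli operators play no role at this level. -/
def labels (ψ : Conf d → ℂ) : AddSubgroup (Conf d × Conf d) where
  carrier := {ab | ∃ c : ℂ, ‖c‖ = 1 ∧ ∀ t, pairing ab.2 t * ψ (t + ab.1) = c * ψ t}
  zero_mem' := ⟨1, by simp, fun t => by simp [pairing_zero_left]⟩
  add_mem' := by
    rintro ⟨a, b⟩ ⟨a', b'⟩ ⟨c, hc, h⟩ ⟨c', hc', h'⟩
    refine ⟨c * c' * (pairing b a')⁻¹, by simp [hc, hc', norm_pairing], fun t => ?_⟩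
    have h1 := h (t + a')
    have h2 := h' t
    simp only [pairing_add_right, Prod.mk_add_mk, pairing_add_left] at h1 h2 ⊢
    have h0 := pairing_ne_zero b a'
    rw [add_comm a a', ← add_assoc]
    field_simp
    linear_combination pairing b' t * h1 + c * h2
  neg_mem' := by
    rintro ⟨a, b⟩ ⟨c, hc, h⟩
    have hc0 : c ≠ 0 := by rintro rfl; simp at hc
    refine ⟨c⁻¹ * (pairing b a)⁻¹, by simp [hc, norm_pairing], fun t => ?_⟩
    have h1 := h (t + -a)
    have h0 := pairing_ne_zero b a
    have h0' := pairing_ne_zero b t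
    simp only [pairing_add_right, pairing_neg_right, Prod.neg_mk, pairing_neg_left,
      neg_add_cancel_right] at h1 ⊢
    field_simp at h1 ⊢
    linear_combination -h1

theorem mem_labels {ψ : Conf d → ℂ} {a b : Conf d} :
    (a, b) ∈ labels ψ ↔ ∃ c : ℂ, ‖c‖ = 1 ∧ ∀ t, pairing b t * ψ (t + a) = c * ψ t :=
  Iff.rfl

theorem mem_labels_iff_mulVec {ψ : Conf d → ℂ} {a b : Conf d} :
    (a, b) ∈ labels ψ ↔
      ∃ c : ℂ, ‖c‖ = 1 ∧ tensorOp (fun i => weyl (a i) (b i)) *ᵥ ψ = c • ψ := by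
  simp only [mem_labels, funext_iff, tensorOp_weyl_mulVec, Pi.smul_apply, smul_eq_mul]

/-- Two Weyl operators with a common eigenvector commute: the labels form an isotropic subgroup for
the symplectic form. -/
theorem labels_isotropic {ψ : Conf d → ℂ} (hψ : ψ ≠ 0) {a b a' b' : Conf d}
    (h : (a, b) ∈ labels ψ) (h' : (a', b') ∈ labels ψ) : pairing b a' = pairing b' a := by
  obtain ⟨c, -, h⟩ := h
  obtain ⟨c', -, h'⟩ := h'
  obtain ⟨t, ht⟩ := Function.ne_iff.mp hψ
  have hc0 : c * c' * ψ t ≠ 0 := by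
    have h0 : ∀ (f : ℂ) (a b : Conf d), f = 0 →
        (∀ t, pairing b t * ψ (t + a) = f * ψ t) → False := by
      intro f a b hf h
      have := h (t + -a)
      rw [hf, zero_mul, neg_add_cancel_right] at this
      exact mul_ne_zero (pairing_ne_zero _ _) ht this
    exact mul_ne_zero (mul_ne_zero (fun hc => h0 c a b hc h) (fun hc => h0 c' a' b' hc h')) ht
  have h1 := h (t + a')
  have h2 := h' t
  have h3 := h' (t + a)
  have h4 := h t
  simp only [pairing_add_right] at h1 h3
  rw [add_right_comm t a' a] at h1
  have e : (pairing b a' - pairing b' a) * (c * c' * ψ t) = 0 := by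
    have e1 : pairing b' t * pairing b t * pairing b a' * ψ (t + a + a') = c * c' * ψ t := by
      linear_combination pairing b' t * h1 + c * h2
    have e2 : pairing b' t * pairing b t * pairing b' a * ψ (t + a + a') = c * c' * ψ t := by
      linear_combination pairing b t * h3 + c' * h4
    linear_combination -(pairing b a') * e2 + (pairing b' a) * e1
  exact sub_eq_zero.mp ((mul_eq_zero.mp e).resolve_right hc0)

/-- A local operator that intertwines Weyl operators site by site maps labels to labels. -/
theorem labels_mulVec {V : ∀ i, Matrix (ZMod (d i)) (ZMod (d i)) ℂ} {a b a' b' : Conf d}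
    (hV : ∀ i, ∃ c : ℂ, ‖c‖ = 1 ∧ V i * weyl (a i) (b i) = c • (weyl (a' i) (b' i) * V i))
    {ψ : Conf d → ℂ} (h : (a, b) ∈ labels ψ) : (a', b') ∈ labels (tensorOp V *ᵥ ψ) := by
  choose c hc hV using hV
  obtain ⟨e, he, h⟩ := mem_labels_iff_mulVec.mp h
  refine mem_labels_iff_mulVec.mpr ⟨(∏ i, c i)⁻¹ * e, by simp [norm_prod, hc, he], ?_⟩
  have h0 : ∏ i, c i ≠ 0 := by
    intro h0
    have : ‖∏ i, c i‖ = 1 := by simp [norm_prod, hc]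
    simp [h0] at this
  have key : tensorOp V * tensorOp (fun i => weyl (a i) (b i)) =
      (∏ i, c i) • (tensorOp (fun i => weyl (a' i) (b' i)) * tensorOp V) := by
    simp only [tensorOp_mul, hV, tensorOp_smul]
  have h2 := congrArg (fun v => tensorOp V *ᵥ v) h
  simp only [mulVec_mulVec, key, smul_mulVec, mulVec_smul] at h2
  rw [mulVec_mulVec, mul_smul, ← h2, smul_smul, inv_mul_cancel₀ h0, one_smul]

end Labels

/-! ### One-qudit Clifford operators -/

section OneQudit

variable {p : ℕ} [NeZero p]

theorem star_stdAddChar (x : ZMod p) : star (stdAddChar x : ℂ) = stdAddChar (-x) := by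
  rw [AddChar.map_neg_eq_conj]; rfl

/-- The unitary discrete Fourier transform on `ℂ^p`. -/
def fourier (p : ℕ) [NeZero p] : Matrix (ZMod p) (ZMod p) ℂ :=
  Matrix.of fun s t => ((Real.sqrt p : ℝ) : ℂ)⁻¹ * stdAddChar (s * t)

theorem sum_stdAddChar_mul (x : ZMod p) :
    ∑ u, (stdAddChar (u * x) : ℂ) = if x = 0 then (p : ℂ) else 0 := by
  rw [AddChar.sum_mulShift x (isPrimitive_stdAddChar p), ZMod.card]
  split_ifs <;> simp

omit [NeZero p] in
theorem sqrt_inv_mul_self : ((Real.sqrt p : ℝ) : ℂ)⁻¹ * ((Real.sqrt p : ℝ) : ℂ)⁻¹ = (p : ℂ)⁻¹ := by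
  rw [← mul_inv, ← Complex.ofReal_mul, Real.mul_self_sqrt (Nat.cast_nonneg p)]
  simp

theorem fourier_isometry : (fourier p)ᴴ * fourier p = 1 := by
  have hp : (p : ℂ) ≠ 0 := Nat.cast_ne_zero.mpr (NeZero.ne p)
  ext s t
  have h : ∀ u, (fourier p)ᴴ s u * fourier p u t = (p : ℂ)⁻¹ * stdAddChar (u * (t - s)) := by
    intro u
    simp only [fourier, conjTranspose_apply, of_apply, star_mul', star_stdAddChar, star_inv₀]
    rw [mul_sub, sub_eq_add_neg, AddChar.map_add_eq_mul, ← sqrt_inv_mul_self, Complex.star_def,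
      Complex.conj_ofReal]
    ring
  rw [mul_apply, Finset.sum_congr rfl fun u _ => h u, ← Finset.mul_sum, sum_stdAddChar_mul,
    one_apply]
  simp only [sub_eq_zero, eq_comm (a := t)]
  split_ifs
  · exact inv_mul_cancel₀ hp
  · simp

theorem mul_weyl_apply (M : Matrix (ZMod p) (ZMod p) ℂ) (a b s t : ZMod p) :
    (M * weyl a b) s t = M s (t - a) * stdAddChar (b * (t - a)) := by
  rw [mul_apply, Finset.sum_eq_single (t - a)]
  · simp [weyl]
  · intro u _ hu
    have : ¬ t = u + a := fun h => hu (by simp [h])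
    simp [weyl, this]
  · simp

theorem weyl_mul_apply (M : Matrix (ZMod p) (ZMod p) ℂ) (a b s t : ZMod p) :
    (weyl a b * M) s t = stdAddChar (b * s) * M (s + a) t := by
  rw [mul_apply, Finset.sum_eq_single (s + a)]
  · simp [weyl]
  · intro u _ hu
    simp [weyl, hu]
  · simp

theorem fourier_mul_weyl (a b : ZMod p) :
    fourier p * weyl a b = (stdAddChar (-(b * a)) : ℂ) • (weyl b (-a) * fourier p) := by
  ext s t
  rw [Matrix.smul_apply, mul_weyl_apply, weyl_mul_apply]
  simp only [fourier, of_apply, smul_eq_mul]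
  rw [mul_assoc, ← AddChar.map_add_eq_mul, mul_left_comm (stdAddChar (-a * s)),
    mul_left_comm, ← AddChar.map_add_eq_mul, ← AddChar.map_add_eq_mul]
  congr 2
  ring

/-- An intertwining relation for an isometry can be read backwards. -/
theorem adjoint_mul_eq {W A B : Matrix (ZMod p) (ZMod p) ℂ} (hW : Wᴴ * W = 1) {c : ℂ}
    (hc : ‖c‖ = 1) (h : W * A = c • (B * W)) : Wᴴ * B = c⁻¹ • (A * Wᴴ) := by
  have hc0 : c ≠ 0 := by rintro rfl; simp at hc
  have hW' : W * Wᴴ = 1 := mul_eq_one_comm.mp hW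
  have h2 : A * Wᴴ = c • (Wᴴ * B) := by
    calc A * Wᴴ = Wᴴ * (W * A) * Wᴴ := by rw [← Matrix.mul_assoc, hW, Matrix.one_mul]
      _ = c • (Wᴴ * B * (W * Wᴴ)) := by
        rw [h, Matrix.mul_smul, Matrix.smul_mul]; simp only [Matrix.mul_assoc]
      _ = c • (Wᴴ * B) := by rw [hW', Matrix.mul_one]
  rw [h2, smul_smul, inv_mul_cancel₀ hc0, one_smul]

/-- For prime `p` there is a quadratic phase function `r` on `ZMod p` with polarization
`(s, a) ↦ ω ^ (α s a)`. For odd `p` it is `ω ^ (α x² / 2)`; for `p = 2` it needs the fourth root of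
unity `i`. -/
theorem exists_quadratic_phase (hp : p.Prime) (α : ZMod p) :
    ∃ r : ZMod p → ℂ, (∀ x, ‖r x‖ = 1) ∧
      ∀ s a, r (s + a) = r s * r a * stdAddChar (α * a * s) := by
  rcases hp.eq_two_or_odd' with rfl | hodd
  · have h1 : (stdAddChar (1 : ZMod 2) : ℂ) = -1 := by
      have h := stdAddChar_coe (N := 2) 1
      rw [Int.cast_one] at h
      rw [h]
      have : 2 * (Real.pi : ℂ) * Complex.I * ((1 : ℤ) : ℂ) / ((2 : ℕ) : ℂ) =
          Real.pi * Complex.I := by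
        push_cast; ring
      rw [this, Complex.exp_pi_mul_I]
    have h2 : (1 + 1 : ZMod 2) = 0 := by decide
    have h01 : ∀ x : ZMod 2, x = 0 ∨ x = 1 := by decide
    rcases h01 α with rfl | rfl
    · exact ⟨fun _ => 1, by simp, by simp⟩
    · refine ⟨fun x => if x = 0 then 1 else Complex.I, fun x => ?_, fun s a => ?_⟩
      · dsimp only
        split_ifs <;> simp
      · rcases h01 s with rfl | rfl <;> rcases h01 a with rfl | rfl <;> simp [h1, h2]
  · have := Fact.mk hp
    have h2 : (2 : ZMod p) ≠ 0 := by
      intro h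
      have h' : ((2 : ℕ) : ZMod p) = 0 := by exact_mod_cast h
      rw [natCast_eq_zero_iff] at h'
      have := (Nat.prime_dvd_prime_iff_eq hp Nat.prime_two).mp h'
      subst this
      exact absurd hodd (by decide)
    refine ⟨fun x => stdAddChar (α / 2 * x ^ 2), fun x => norm_stdAddChar _, fun s a => ?_⟩
    simp only [← AddChar.map_add_eq_mul]
    congr 1
    field_simp
    ring

theorem diagonal_isometry {r : ZMod p → ℂ} (hr : ∀ x, ‖r x‖ = 1) :
    (diagonal r)ᴴ * diagonal r = 1 := by
  rw [diagonal_conjTranspose, diagonal_mul_diagonal, ← diagonal_one]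
  congr 1
  funext x
  rw [Pi.star_apply, Complex.star_def, Complex.conj_mul', hr]
  simp

theorem diagonal_mul_weyl {r : ZMod p → ℂ} (hr : ∀ x, ‖r x‖ = 1) {α : ZMod p}
    (h : ∀ s a, r (s + a) = r s * r a * stdAddChar (α * a * s)) (a b : ZMod p) :
    diagonal r * weyl a b = (r a)⁻¹ • (weyl a (b - α * a) * diagonal r) := by
  have h0 : r a ≠ 0 := fun h0 => by have := hr a; simp [h0] at this
  ext s t
  rw [Matrix.smul_apply, diagonal_mul, mul_diagonal]
  simp only [weyl, of_apply, smul_eq_mul]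
  split_ifs with ht
  · subst ht
    rw [h, sub_mul, sub_eq_add_neg, AddChar.map_add_eq_mul, AddChar.map_neg_eq_inv]
    have h1 := stdAddChar_ne_zero (α * a * s)
    field_simp
  · simp

/-- The shear `(a, b) ↦ (a + α b, b)` of Weyl labels is implemented by a unitary, a quadratic phase
conjugated by the Fourier transform. -/
theorem exists_shear (hp : p.Prime) (α : ZMod p) :
    ∃ T : Matrix (ZMod p) (ZMod p) ℂ, Tᴴ * T = 1 ∧
      ∀ a b, ∃ c : ℂ, ‖c‖ = 1 ∧ T * weyl a b = c • (weyl (a + α * b) b * T) := by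
  obtain ⟨r, hr, h⟩ := exists_quadratic_phase hp α
  have hF : fourier p * (fourier p)ᴴ = 1 := mul_eq_one_comm.mp fourier_isometry
  refine ⟨(fourier p)ᴴ * (diagonal r * fourier p), ?_, fun a b => ?_⟩
  · simp only [conjTranspose_mul, conjTranspose_conjTranspose, Matrix.mul_assoc]
    rw [← Matrix.mul_assoc (fourier p) (fourier p)ᴴ, hF, Matrix.one_mul,
      ← Matrix.mul_assoc (diagonal r)ᴴ, diagonal_isometry hr, Matrix.one_mul, fourier_isometry]
  · have h1 := fourier_mul_weyl a b
    have h2 := diagonal_mul_weyl hr h b (-a)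
    have h3 := adjoint_mul_eq fourier_isometry (norm_stdAddChar _)
      (fourier_mul_weyl (a + α * b) b)
    rw [show -(a + α * b) = -a - α * b by ring] at h3
    refine ⟨stdAddChar (-(b * a)) * ((r b)⁻¹ * (stdAddChar (-(b * (a + α * b))))⁻¹), ?_, ?_⟩
    · simp [hr]
    · rw [Matrix.mul_assoc, Matrix.mul_assoc, h1, Matrix.mul_smul, ← Matrix.mul_assoc (diagonal r),
        h2, Matrix.smul_mul, Matrix.mul_smul, Matrix.mul_smul, ← Matrix.mul_assoc,
        ← Matrix.mul_assoc, h3]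
      simp only [Matrix.smul_mul, smul_smul, Matrix.mul_assoc]

end OneQudit

/-! ### Local Clifford operators and transversality -/

section Site

variable [∀ i, NeZero (d i)]

/-- The local operators given by `W` at site `i` and by the identity elsewhere. -/
def siteOp (i : Fin n) (W : Matrix (ZMod (d i)) (ZMod (d i)) ℂ) :
    ∀ j, Matrix (ZMod (d j)) (ZMod (d j)) ℂ :=
  Function.update (fun _ => 1) i W

theorem siteOp_isometry {i : Fin n} {W : Matrix (ZMod (d i)) (ZMod (d i)) ℂ} (hW : Wᴴ * W = 1)
    (j : Fin n) : (siteOp i W j)ᴴ * siteOp i W j = 1 := by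
  rcases eq_or_ne j i with rfl | h
  · simpa [siteOp] using hW
  · simp [siteOp, h]

theorem labels_siteOp {i : Fin n} {W : Matrix (ZMod (d i)) (ZMod (d i)) ℂ} {a b : Conf d}
    {x y : ZMod (d i)}
    (hW : ∃ c : ℂ, ‖c‖ = 1 ∧ W * weyl (a i) (b i) = c • (weyl x y * W))
    {ψ : Conf d → ℂ} (h : (a, b) ∈ labels ψ) :
    (Function.update a i x, Function.update b i y) ∈ labels (tensorOp (siteOp i W) *ᵥ ψ) := by
  refine labels_mulVec (fun j => ?_) h
  rcases eq_or_ne j i with rfl | hj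
  · simpa [siteOp] using hW
  · exact ⟨1, by simp, by simp [siteOp, hj]⟩

theorem labels_fourier (i : Fin n) {a b : Conf d} {ψ : Conf d → ℂ} (h : (a, b) ∈ labels ψ) :
    (Function.update a i (b i), Function.update b i (-a i)) ∈
      labels (tensorOp (siteOp i (fourier (d i))) *ᵥ ψ) :=
  labels_siteOp ⟨_, norm_stdAddChar _, fourier_mul_weyl _ _⟩ h

theorem labels_of_fourier (i : Fin n) {a b : Conf d} {ψ : Conf d → ℂ}
    (h : (a, b) ∈ labels (tensorOp (siteOp i (fourier (d i))) *ᵥ ψ)) :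
    (Function.update a i (-b i), Function.update b i (a i)) ∈ labels ψ := by
  have hF : fourier (d i) * weyl (-b i) (a i) = (stdAddChar (-(a i * -b i)) : ℂ) •
      (weyl (a i) (b i) * fourier (d i)) := by
    have := fourier_mul_weyl (-b i) (a i)
    rwa [neg_neg] at this
  have h2 := labels_siteOp (i := i) (W := (fourier (d i))ᴴ)
    ⟨_, by rw [norm_inv, norm_stdAddChar, inv_one],
      adjoint_mul_eq fourier_isometry (norm_stdAddChar _) hF⟩ h
  rw [mulVec_mulVec, tensorOp_mul] at h2
  have h3 : (fun j => siteOp i (fourier (d i))ᴴ j * siteOp i (fourier (d i)) j) = fun _ => 1 := by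
    funext j
    rcases eq_or_ne j i with rfl | hj
    · simpa [siteOp] using fourier_isometry
    · simp [siteOp, hj]
  rwa [h3, tensorOp_one, one_mulVec] at h2

theorem ne_zero_of_unit {ψ : Conf d → ℂ} (h : star ψ ⬝ᵥ ψ = 1) : ψ ≠ 0 := by
  rintro rfl
  simp at h

/-- Local Fourier transforms make the labels of a state transverse to the labels `(0, b)`. At each
site one of the two axes can be chosen greedily: if both choices failed, two elements of the labels
would violate isotropy. -/
theorem exists_transverse (hd : ∀ i, (d i).Prime) {ψ : Conf d → ℂ} (hψ : star ψ ⬝ᵥ ψ = 1) :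
    ∃ φ, LUEquiv φ ψ ∧ Nat.card (labels ψ) ≤ Nat.card (labels φ) ∧
      ∀ b : Conf d, (0, b) ∈ labels φ → b = 0 := by
  suffices H : ∀ s : Finset (Fin n), ∃ φ, LUEquiv φ ψ ∧
      Nat.card (labels ψ) ≤ Nat.card (labels φ) ∧
      ∀ b : Conf d, (0, b) ∈ labels φ → (∀ j ∉ s, b j = 0) → b = 0 by
    obtain ⟨φ, h1, h2, h3⟩ := H Finset.univ
    exact ⟨φ, h1, h2, fun b hb => h3 b hb (by simp)⟩
  intro s
  induction s using Finset.induction_on with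
  | empty =>
    exact ⟨ψ, LUEquiv.refl ψ, le_rfl, fun b _ hb => funext fun j => hb j (by simp)⟩
  | insert i s hi ih =>
    obtain ⟨φ, hLU, hcard, hs⟩ := ih
    by_cases hgood : ∀ b : Conf d, (0, b) ∈ labels φ → (∀ j ∉ insert i s, b j = 0) → b = 0
    · exact ⟨φ, hLU, hcard, hgood⟩
    push Not at hgood
    obtain ⟨w, hw, hws, hw0⟩ := hgood
    have hwi : w i ≠ 0 := by
      intro h
      refine hw0 (hs w hw fun j hj => ?_)
      rcases eq_or_ne j i with rfl | hji
      · exact h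
      · exact hws j (by simp [hj, hji])
    refine ⟨tensorOp (siteOp i (fourier (d i))) *ᵥ φ,
      (LUEquiv.mulVec (siteOp_isometry fourier_isometry) φ).trans hLU, hcard.trans ?_, ?_⟩
    · refine Nat.card_le_card_of_injective
        (fun ab : labels φ => (⟨_, labels_fourier i (a := ab.1.1) (b := ab.1.2) ab.2⟩ :
          labels (tensorOp (siteOp i (fourier (d i))) *ᵥ φ))) ?_
      rintro ⟨⟨a, b⟩, h⟩ ⟨⟨a', b'⟩, h'⟩ e
      simp only [Subtype.mk.injEq, Prod.mk.injEq] at e ⊢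
      obtain ⟨e1, e2⟩ := e
      constructor
      · funext j
        rcases eq_or_ne j i with rfl | hj
        · simpa using congrFun e2 j
        · simpa [hj] using congrFun e1 j
      · funext j
        rcases eq_or_ne j i with rfl | hj
        · simpa using congrFun e1 j
        · simpa [hj] using congrFun e2 j
    · intro b hb hbs
      have hb' := labels_of_fourier i hb
      have hφ0 : φ ≠ 0 := ne_zero_of_unit (hLU.unit hψ)
      -- isotropy of the preimage of `(0, b)` with `(0, w)` gives `b i * w i = 0`
      have hiso := labels_isotropic hφ0 hw hb'
      have hsing : Function.update (0 : Conf d) i (-b i) = Pi.single i (-b i) := rfl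
      rw [pairing_zero_right, hsing, pairing_single] at hiso
      have hz : w i * -b i = 0 := by
        apply injective_stdAddChar
        rw [hiso, AddChar.map_zero_eq_one]
      have := Fact.mk (hd i)
      have hbi : b i = 0 := by simpa [hwi] using hz
      have e : (Function.update (0 : Conf d) i (-b i), Function.update b i ((0 : Conf d) i)) =
          ((0 : Conf d), b) := by
        rw [hbi]
        simp only [Pi.zero_apply, neg_zero, Prod.mk.injEq]
        constructor
        · exact Function.update_eq_self i (0 : Conf d)
        · rw [← hbi]; exact Function.update_eq_self i b
      rw [e] at hb'
      refine hs b hb' fun j hj => ?_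
      rcases eq_or_ne j i with rfl | hji
      · exact hbi
      · exact hbs j (by simp [hj, hji])

theorem card_conf : Nat.card (Conf d) = ∏ i, d i := by
  rw [Nat.card_eq_fintype_card, Fintype.card_pi]
  simp [ZMod.card]

/-- If there are at least `∏ i, d i` labels and they are transverse to the labels `(0, b)`, every
`a` occurs in a label `(a, b)`. -/
theorem exists_label {φ : Conf d → ℂ} (hcard : ∏ i, d i ≤ Nat.card (labels φ))
    (hφ : ∀ b : Conf d, (0, b) ∈ labels φ → b = 0) (a : Conf d) :
    ∃ b, (a, b) ∈ labels φ := by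
  have hinj : Function.Injective (fun ab : labels φ => ab.1.1) := by
    rintro ⟨⟨a, b⟩, h⟩ ⟨⟨a', b'⟩, h'⟩ e
    dsimp only at e
    subst e
    have h2 := (labels φ).sub_mem h h'
    rw [Prod.mk_sub_mk, sub_self] at h2
    have := sub_eq_zero.mp (hφ _ h2)
    subst this
    rfl
  have hbij : Function.Bijective (fun ab : labels φ => ab.1.1) := by
    refine hinj.bijective_of_nat_card_le ?_
    rw [card_conf]
    exact hcard
  obtain ⟨⟨⟨a', b⟩, h⟩, rfl⟩ := hbij.2 a
  exact ⟨b, h⟩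

/-! ### Stabilizer states have many labels -/

theorem localPauli_eq {p : ℕ} [NeZero p] {P : Matrix (ZMod p) (ZMod p) ℂ} (h : P ∈ localPauli p) :
    ∃ (c : ℂ) (a b : ZMod p), ‖c‖ = 1 ∧ P = c • weyl a b := by
  obtain ⟨c, a, b, hc, rfl⟩ := h
  refine ⟨c * stdAddChar (-(b * a)), -a, b, ?_, ?_⟩
  · rw [norm_mul, norm_stdAddChar, mul_one]
    refine Complex.norm_eq_one_of_pow_eq_one hc ?_
    split_ifs
    · decide
    · exact NeZero.ne p
  · rw [pauliX_pow_mul_pauliZ_pow, smul_smul]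

theorem card_labels_of_mem_stabStates {ψ : Conf d → ℂ} (h : ψ ∈ stabStates d) :
    ∏ i, d i ≤ Nat.card (labels ψ) := by
  obtain ⟨-, S, hS, hfix⟩ := h
  have hP : ∀ s : S, ∃ (c : ℂ) (ab : Conf d × Conf d), ‖c‖ = 1 ∧
      ((s : unitaryGroup (Conf d) ℂ) : Matrix (Conf d) (Conf d) ℂ) =
        c • tensorOp fun i => weyl (ab.1 i) (ab.2 i) := by
    intro s
    obtain ⟨Q, hQ, e⟩ := hS.pauli s.1 s.2
    choose c a b hc hQ using fun i => localPauli_eq (hQ i)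
    refine ⟨∏ i, c i, (a, b), by simp [norm_prod, hc], ?_⟩
    rw [e, ← tensorOp_smul]
    congr 1
    funext i
    exact hQ i
  choose c ab hc hs using hP
  have hc0 : ∀ s, c s ≠ 0 := fun s h0 => by have := hc s; simp [h0] at this
  have hmem : ∀ s, ab s ∈ labels ψ := by
    intro s
    refine mem_labels_iff_mulVec.mpr ⟨(c s)⁻¹, by simp [hc], ?_⟩
    have h1 := hfix s.1 s.2
    rw [hs, smul_mulVec] at h1
    conv_rhs => rw [← h1]
    rw [smul_smul, inv_mul_cancel₀ (hc0 s), one_smul]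
  rw [← hS.card_eq]
  refine Nat.card_le_card_of_injective (fun s => (⟨ab s, hmem s⟩ : labels ψ)) ?_
  intro s s' e
  have e : ab s = ab s' := congrArg Subtype.val e
  -- operators with equal labels differ by a scalar, and the only scalar in `S` is the identity
  have h1 : ((s : unitaryGroup (Conf d) ℂ) : Matrix (Conf d) (Conf d) ℂ) =
      (c s * (c s')⁻¹) • ((s' : unitaryGroup (Conf d) ℂ) : Matrix (Conf d) (Conf d) ℂ) := by
    rw [hs, hs, e, smul_smul, inv_mul_cancel_right₀ (hc0 s')]
  have h2 : ((s.1 * s'.1⁻¹ : unitaryGroup (Conf d) ℂ) : Matrix (Conf d) (Conf d) ℂ) =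
      (c s * (c s')⁻¹) • (1 : Matrix (Conf d) (Conf d) ℂ) := by
    have h3 : ((s'.1 * s'.1⁻¹ : unitaryGroup (Conf d) ℂ) : Matrix (Conf d) (Conf d) ℂ) = 1 := by
      rw [mul_inv_cancel]; rfl
    rw [Submonoid.coe_mul] at h3 ⊢
    rw [h1, Matrix.smul_mul, h3]
  have h4 := hS.no_scalar _ (S.mul_mem s.2 (S.inv_mem s'.2)) _ h2
  rw [h4, one_smul] at h1
  exact Subtype.ext (Subtype.ext h1)

end Site

/-! ### Entries of a direct sum of adjacency matrices -/

section DirectSum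

variable [∀ i, NeZero (d i)] (A : BlockAdj d)

omit [∀ i, NeZero (d i)] in
theorem directSum_of_ne {i j : Fin n} (h : d j ≠ d i) : directSum A i j = 0 := dif_neg h

omit [∀ i, NeZero (d i)] in
theorem directSum_self (i : Fin n) : directSum A i i = 0 := by
  rw [directSum, dif_pos rfl]
  exact (A ⟨d i, i, rfl⟩).2.2 _

/-- Entries of the direct sum, transported to `ZMod p` through their representatives in `ℕ`. -/
theorem directSum_val_cast {p : Set.range d} {i j : Fin n} (hi : d i = p) (hj : d j = p) :
    ((directSum A i j).val : ZMod p) = (A p).1 ⟨i, hi⟩ ⟨j, hj⟩ := by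
  obtain ⟨p, hp⟩ := p
  dsimp only at hi hj
  subst hi
  rw [natCast_zmod_val, directSum, dif_pos hj]

theorem directSum_val_cast_symm (i j : Fin n) :
    ((directSum A i j).val : ZMod (d j)) = directSum A j i := by
  by_cases h : d i = d j
  · have h1 := directSum_val_cast A (p := ⟨d j, j, rfl⟩) (i := i) (j := j) h rfl
    have h2 := directSum_val_cast A (p := ⟨d j, j, rfl⟩) (i := j) (j := i) rfl h
    dsimp only at h1 h2
    rw [natCast_zmod_val] at h2
    rw [h1, h2]
    exact ((A ⟨d j, j, rfl⟩).2.1.apply _ _)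
  · rw [directSum_of_ne A (fun h' => h h'.symm), directSum_of_ne A h]
    simp

omit [∀ i, NeZero (d i)] in
theorem stdAddChar_val_cast {p q : ℕ} [NeZero p] [NeZero q] (h : p = q) (x : ZMod p) :
    (stdAddChar ((x.val : ℕ) : ZMod q) : ℂ) = stdAddChar x := by
  subst h
  rw [natCast_zmod_val]

/-- The phase that the controlled phase gate of the edge `{i, j}` gives to the labels `x` and `y`
of its ends. -/
def edgePhase (i j : Fin n) (x : ZMod (d i)) (y : ZMod (d j)) : ℂ :=
  stdAddChar (directSum A i j * (y.val : ZMod (d i)) * x)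

theorem edgePhase_symm (i j : Fin n) (x : ZMod (d i)) (y : ZMod (d j)) :
    edgePhase A i j x y = edgePhase A j i y x := by
  rw [edgePhase, edgePhase]
  by_cases h : d i = d j
  · have e : ((directSum A i j * (y.val : ZMod (d i)) * x : ZMod (d i)).val : ZMod (d j)) =
        directSum A j i * (x.val : ZMod (d j)) * y := by
      rw [← directSum_val_cast_symm A i j]
      generalize directSum A i j = w
      have : ∀ (p q : ℕ) [NeZero p] [NeZero q] (_ : p = q) (x w : ZMod p) (y : ZMod q),
          ((w * (y.val : ZMod p) * x : ZMod p).val : ZMod q) =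
            (w.val : ZMod q) * (x.val : ZMod q) * y := by
        intro p q _ _ h x w y
        subst h
        simp only [natCast_zmod_val]
        ring
      exact this _ _ h x w y
    rw [← e, stdAddChar_val_cast h]
  · rw [directSum_of_ne A (fun h' => h h'.symm), directSum_of_ne A h]
    simp

theorem edgePhase_add_left (i j : Fin n) (x x' : ZMod (d i)) (y : ZMod (d j)) :
    edgePhase A i j (x + x') y = edgePhase A i j x y * edgePhase A i j x' y := by
  rw [edgePhase, mul_add, AddChar.map_add_eq_mul]
  rfl

theorem edgePhase_add_right (i j : Fin n) (x : ZMod (d i)) (y y' : ZMod (d j)) :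
    edgePhase A i j x (y + y') = edgePhase A i j x y * edgePhase A i j x y' := by
  simp only [edgePhase_symm A i j, edgePhase_add_left]

theorem edgePhase_self (i : Fin n) (x y : ZMod (d i)) : edgePhase A i i x y = 1 := by
  simp [edgePhase, directSum_self]

theorem prod_pairs_mul_swap (f : Fin n → Fin n → ℂ) (hf : ∀ i, f i i = 1) :
    ∏ e ∈ Finset.univ.filter (fun e : Fin n × Fin n => e.1 < e.2), f e.1 e.2 * f e.2 e.1 =
      ∏ i, ∏ j, f i j := by
  rw [Finset.prod_mul_distrib, Finset.prod_filter, Finset.prod_filter, ← Finset.univ_product_univ,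
    Finset.prod_product, Finset.prod_product]
  dsimp only
  rw [Finset.prod_comm (f := fun i j => if i < j then f j i else 1), ← Finset.prod_mul_distrib]
  refine Finset.prod_congr rfl fun i _ => ?_
  rw [← Finset.prod_mul_distrib]
  refine Finset.prod_congr rfl fun j _ => ?_
  rcases lt_trichotomy i j with h | rfl | h
  · simp [h, h.le.not_gt]
  · simp [hf]
  · simp [h, h.le.not_gt]

/-! ### Graph states -/

/-- The amplitudes of the graph state, up to normalization. -/
def graphAmp (t : Conf d) : ℂ :=
  ∏ e ∈ Finset.univ.filter (fun e : Fin n × Fin n => e.1 < e.2), edgePhase A e.1 e.2 (t e.1) (t e.2)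

/-- The neighbourhood map `a ↦ A a`, computed in `ZMod (d i)` at the site `i`. -/
def neighbour (a : Conf d) : Conf d := fun i => ∑ j, directSum A i j * ((a j).val : ZMod (d i))

omit [∀ i, NeZero (d i)] in
theorem stdAddChar_sum {p : ℕ} [NeZero p] {ι : Type*} (s : Finset ι) (f : ι → ZMod p) :
    (stdAddChar (∑ i ∈ s, f i) : ℂ) = ∏ i ∈ s, stdAddChar (f i) := by
  classical
  induction s using Finset.induction_on with
  | empty => simp
  | insert i s hi ih => rw [Finset.sum_insert hi, Finset.prod_insert hi, AddChar.map_add_eq_mul, ih]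

theorem graphAmp_add (t a : Conf d) :
    graphAmp A (t + a) = graphAmp A t * graphAmp A a * pairing (neighbour A a) t := by
  have h : pairing (neighbour A a) t = ∏ i, ∏ j, edgePhase A i j (t i) (a j) := by
    simp only [pairing, neighbour, Finset.sum_mul, stdAddChar_sum]
    rfl
  rw [h, ← prod_pairs_mul_swap _ fun i => edgePhase_self A i _ _]
  simp only [graphAmp, ← Finset.prod_mul_distrib]
  refine Finset.prod_congr rfl fun e _ => ?_
  rw [Pi.add_apply, Pi.add_apply, edgePhase_add_left, edgePhase_add_right, edgePhase_add_right,
    edgePhase_symm A e.1 e.2 (a e.1) (t e.2)]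
  ring

theorem norm_graphAmp (t : Conf d) : ‖graphAmp A t‖ = 1 := by
  simp [graphAmp, norm_prod, edgePhase]

theorem graphAmp_ne_zero (t : Conf d) : graphAmp A t ≠ 0 := fun h => by
  have := norm_graphAmp A t
  simp [h] at this

theorem neighbour_single (hd : ∀ i, (d i).Prime) (i j : Fin n) :
    neighbour A (Pi.single i 1) j = directSum A j i := by
  have : Fact (1 < d i) := ⟨(hd i).one_lt⟩
  rw [neighbour, Finset.sum_eq_single i]
  · simp [ZMod.val_one]
  · intro k _ hk
    simp [Pi.single_eq_of_ne hk]
  · simp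

theorem graphState_apply (t : Conf d) :
    graphState (directSum A) t = (∏ i, ((Real.sqrt (d i) : ℝ) : ℂ)⁻¹) * graphAmp A t := by
  have h : ∀ e : Fin n × Fin n, (CP e.1 e.2 : Matrix (Conf d) (Conf d) ℂ) ^
      (directSum A e.1 e.2).val =
      diagonalRingHom (Conf d) ℂ (fun s => edgePhase A e.1 e.2 (s e.1) (s e.2)) := by
    intro e
    rw [CP, diagonal_pow, diagonalRingHom_apply]
    congr 1
    funext s
    rw [Pi.pow_apply, ← AddChar.map_nsmul_eq_pow, edgePhase_symm, edgePhase]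
    congr 1
    rw [nsmul_eq_mul, directSum_val_cast_symm, mul_assoc]
  have hprod : ∀ comm, Finset.noncommProd
      (Finset.univ.filter fun e : Fin n × Fin n => e.1 < e.2)
      (fun e => (CP e.1 e.2 : Matrix (Conf d) (Conf d) ℂ) ^ (directSum A e.1 e.2).val) comm =
      diagonal (graphAmp A) := by
    intro comm
    refine (Finset.noncommProd_congr rfl (fun e _ => h e) comm).trans ?_
    refine (Finset.map_noncommProd _
      (fun (e : Fin n × Fin n) (s : Conf d) => edgePhase A e.1 e.2 (s e.1) (s e.2))
      (fun _ _ _ _ _ => Commute.all _ _) (diagonalRingHom (Conf d) ℂ)).symm.trans ?_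
    rw [Finset.noncommProd_eq_prod, diagonalRingHom_apply]
    congr 1
    funext s
    rw [Finset.prod_apply, graphAmp]
  refine (congrArg (fun M => (M *ᵥ plusState) t) (hprod _)).trans ?_
  rw [mulVec_diagonal, plusState, mul_comm]

theorem graphState_eq :
    graphState (directSum A) = (∏ i, ((Real.sqrt (d i) : ℝ) : ℂ)⁻¹) • graphAmp A :=
  funext fun t => graphState_apply A t

theorem graphState_unit : star (graphState (directSum A)) ⬝ᵥ graphState (directSum A) = 1 := by
  have h : ∀ t, star (graphState (directSum A)) t * graphState (directSum A) t =
      (∏ i, (d i : ℂ))⁻¹ := by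
    intro t
    have h1 : star (∏ i, ((Real.sqrt (d i) : ℝ) : ℂ)⁻¹) * ∏ i, ((Real.sqrt (d i) : ℝ) : ℂ)⁻¹ =
        (∏ i, (d i : ℂ))⁻¹ := by
      rw [star_prod, ← Finset.prod_mul_distrib, ← Finset.prod_inv_distrib]
      refine Finset.prod_congr rfl fun i _ => ?_
      rw [star_inv₀, Complex.star_def, Complex.conj_ofReal, sqrt_inv_mul_self]
    have h2 : star (graphAmp A t) * graphAmp A t = 1 := by
      rw [Complex.star_def, Complex.conj_mul', norm_graphAmp]
      simp
    rw [Pi.star_apply, graphState_apply, star_mul', ← h1]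
    linear_combination (star (∏ i, ((Real.sqrt (d i) : ℝ) : ℂ)⁻¹) *
      ∏ i, ((Real.sqrt (d i) : ℝ) : ℂ)⁻¹) * h2
  have h0 : (∏ i, (d i : ℂ)) ≠ 0 :=
    Finset.prod_ne_zero_iff.mpr fun i _ => Nat.cast_ne_zero.mpr (NeZero.ne _)
  rw [dotProduct, Finset.sum_congr rfl fun t _ => h t, Finset.sum_const, Finset.card_univ,
    ← Nat.card_eq_fintype_card, card_conf, nsmul_eq_mul, Nat.cast_prod, mul_inv_cancel₀ h0]

/-- The label of the inverse of the stabilizer element `X^a Z^(A a)`, up to a phase. -/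
theorem labels_graphState (a : Conf d) :
    (a, -neighbour A a) ∈ labels (graphState (directSum A)) := by
  refine mem_labels.mpr ⟨graphAmp A a, norm_graphAmp A a, fun t => ?_⟩
  rw [graphState_apply, graphState_apply, graphAmp_add, pairing_neg_left]
  have := pairing_ne_zero (neighbour A a) t
  field_simp

theorem labels_graphState_single (hd : ∀ i, (d i).Prime) (i : Fin n) :
    ((Pi.single i 1 : Conf d), (fun j => -directSum A j i : Conf d)) ∈
      labels (graphState (directSum A)) := by
  have h := labels_graphState A (Pi.single i 1)
  have e : -neighbour A (Pi.single i 1) = fun j => -directSum A j i :=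
    funext fun j => by rw [Pi.neg_apply, neighbour_single A hd]
  rwa [e] at h

/-! ### Functions with local multipliers are products of local functions -/

omit A in
/-- A function whose translates along each axis differ from it by a phase depending on that
coordinate only is, up to a constant, a product of one-variable phases. -/
theorem exists_prod_of_translate {q : Conf d → ℂ} {h : ∀ i, ZMod (d i) → ℂ}
    (hh : ∀ i x, ‖h i x‖ = 1) (hq : ∀ i t, q (t + Pi.single i 1) = h i (t i) * q t) :
    ∃ r : ∀ i, ZMod (d i) → ℂ, (∀ i x, ‖r i x‖ = 1) ∧ ∀ t, q t = q 0 * ∏ i, r i (t i) := by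
  refine ⟨fun i x => ∏ k ∈ Finset.range x.val, h i k, fun i x => by simp [norm_prod, hh], ?_⟩
  have h1 : ∀ (i : Fin n) (t : Conf d) (k : ℕ), q (Function.update t i (k : ZMod (d i))) =
      (∏ l ∈ Finset.range k, h i l) * q (Function.update t i 0) := by
    intro i t k
    induction k with
    | zero => simp
    | succ k ih =>
      have e : Function.update t i ((k + 1 : ℕ) : ZMod (d i)) =
          Function.update t i (k : ZMod (d i)) + Pi.single i 1 := by
        funext j
        rcases eq_or_ne j i with rfl | hj
        · simp
        · simp [hj]
      rw [e, hq, ih, Finset.prod_range_succ, Function.update_self]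
      ring
  have h2 : ∀ (s : Finset (Fin n)) (t : Conf d),
      q t = (∏ i ∈ s, ∏ k ∈ Finset.range (t i).val, h i k) * q (s.piecewise 0 t) := by
    intro s t
    induction s using Finset.induction_on with
    | empty => simp
    | insert i s hi ih =>
      have h3 := h1 i (s.piecewise 0 t) (t i).val
      have e : Function.update (s.piecewise 0 t) i (t i) = s.piecewise 0 t := by
        rw [Function.update_eq_self_iff, Finset.piecewise_eq_of_notMem _ _ _ hi]
      rw [natCast_zmod_val, e] at h3
      rw [Finset.prod_insert hi, Finset.piecewise_insert, ih, h3, Pi.zero_apply]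
      ring
  intro t
  have h3 := h2 Finset.univ t
  rw [Finset.piecewise_univ] at h3
  rw [h3, mul_comm]

/-- A unit vector whose labels contain the generators of a graph state, up to powers of `Z_i` in the
`i`-th generator, is equivalent to that graph state by diagonal local unitaries. -/
theorem luEquiv_graphState {ψ : Conf d → ℂ} (hψ : star ψ ⬝ᵥ ψ = 1) (b : Fin n → Conf d)
    (hb : ∀ i j, i ≠ j → b i j = -directSum A j i) (hd : ∀ i, (d i).Prime)
    (h : ∀ i, (Pi.single i 1, b i) ∈ labels ψ) : LUEquiv ψ (graphState (directSum A)) := by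
  choose c hc h using h
  have hq : ∀ i t, ψ (t + Pi.single i 1) / graphAmp A (t + Pi.single i 1) =
      (c i / graphAmp A (Pi.single i 1) * stdAddChar (-b i i * t i)) * (ψ t / graphAmp A t) := by
    intro i t
    have e : pairing (neighbour A (Pi.single i 1)) t * pairing (b i) t =
        stdAddChar (b i i * t i) := by
      rw [← pairing_add_left, pairing, Finset.prod_eq_single i]
      · rw [Pi.add_apply, neighbour_single A hd, directSum_self, zero_add]
      · intro j _ hj
        rw [Pi.add_apply, neighbour_single A hd, hb i j hj.symm]
        simp
      · simp
    have h0 := graphAmp_ne_zero A t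
    have h1 := graphAmp_ne_zero A (Pi.single i 1)
    have h2 := pairing_ne_zero (neighbour A (Pi.single i 1)) t
    have h3 := stdAddChar_ne_zero (b i i * t i)
    rw [graphAmp_add, neg_mul, AddChar.map_neg_eq_inv]
    field_simp
    rw [← e]
    linear_combination pairing (neighbour A (Pi.single i 1)) t * h i t
  obtain ⟨r, hr, hprod⟩ := exists_prod_of_translate (q := fun t => ψ t / graphAmp A t)
    (h := fun i x => c i / graphAmp A (Pi.single i 1) * stdAddChar (-b i i * x))
    (fun i x => by simp [hc, norm_graphAmp]) hq
  have hD : ∀ t u, tensorOp (fun i => diagonal (r i)) t u =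
      diagonal (fun t : Conf d => ∏ i, r i (t i)) t u := by
    intro t u
    by_cases htu : t = u
    · subst htu
      simp [tensorOp]
    · obtain ⟨i, hi⟩ := Function.ne_iff.mp htu
      rw [diagonal_apply_ne _ htu]
      exact Finset.prod_eq_zero (Finset.mem_univ i) (diagonal_apply_ne _ hi)
  have hD : tensorOp (fun i => diagonal (r i)) = diagonal (fun t : Conf d => ∏ i, r i (t i)) :=
    Matrix.ext hD
  have hN : (∏ i, ((Real.sqrt (d i) : ℝ) : ℂ)⁻¹) ≠ 0 :=
    Finset.prod_ne_zero_iff.mpr fun i _ => inv_ne_zero (Complex.ofReal_ne_zero.mpr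
      (Real.sqrt_ne_zero'.mpr (Nat.cast_pos.mpr (NeZero.pos _))))
  obtain ⟨e, he⟩ : ∃ e : ℂ, ψ = e • (tensorOp (fun i => diagonal (r i)) *ᵥ
      graphState (directSum A)) := by
    refine ⟨ψ 0 / graphAmp A 0 * (∏ i, ((Real.sqrt (d i) : ℝ) : ℂ)⁻¹)⁻¹, ?_⟩
    funext t
    rw [hD, Pi.smul_apply, mulVec_diagonal, graphState_apply, smul_eq_mul]
    generalize (∏ i, ((Real.sqrt (d i) : ℝ) : ℂ)⁻¹) = N at hN
    have h0 := graphAmp_ne_zero A t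
    have h1 := hprod t
    rw [div_eq_iff h0] at h1
    rw [h1]
    field_simp
  have hiso : ∀ i, (diagonal (r i))ᴴ * diagonal (r i) = 1 := fun i => diagonal_isometry (hr i)
  refine ⟨fun i => diagonal (r i), hiso, e, ?_, he⟩
  -- both vectors have norm one
  have hunit := (LUEquiv.mulVec hiso (graphState (directSum A))).unit (graphState_unit A)
  rw [he, star_smul, smul_dotProduct, dotProduct_smul, hunit] at hψ
  simp only [smul_eq_mul, mul_one] at hψ
  rw [Complex.star_def, Complex.conj_mul'] at hψ
  have h2 : ‖e‖ ^ 2 = 1 := by exact_mod_cast hψ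
  exact (pow_eq_one_iff_of_nonneg (norm_nonneg e) two_ne_zero).mp h2

omit A in
/-- Every stabilizer state is local unitarily equivalent to a graph state. -/
theorem exists_luEquiv_graphState (hd : ∀ i, (d i).Prime) {ψ : Conf d → ℂ}
    (h : ψ ∈ stabStates d) : ∃ A : BlockAdj d, LUEquiv ψ (graphState (directSum A)) := by
  obtain ⟨φ, hLU, hcard, htrans⟩ := exists_transverse hd h.1
  choose b hb using fun i => exists_label ((card_labels_of_mem_stabStates h).trans hcard) htrans
    (Pi.single i 1)
  have hφ := hLU.unit h.1
  have hsymm : ∀ i j, (stdAddChar (b i j) : ℂ) = stdAddChar (b j i) := by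
    intro i j
    have := labels_isotropic (ne_zero_of_unit hφ) (hb i) (hb j)
    rwa [pairing_single, pairing_single, mul_one, mul_one] at this
  have hcast : ∀ {i j p}, d i = p → d j = p → (((b i j).val : ℕ) : ZMod p) = (b j i).val := by
    intro i j p hi hj
    subst hi
    apply injective_stdAddChar
    rw [stdAddChar_val_cast hj, hsymm, natCast_zmod_val]
  have hpow : ∀ {p : ℕ} [NeZero p] (x : ZMod p), (stdAddChar x : ℂ) ^ p = 1 := by
    intro p _ x
    rw [← AddChar.map_nsmul_eq_pow, nsmul_eq_mul, natCast_self, zero_mul, AddChar.map_zero_eq_one]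
  let A : BlockAdj d := fun p =>
    ⟨Matrix.of fun u w => if u = w then 0 else -(((b w.1 u.1).val : ℕ) : ZMod p), by
      constructor
      · ext u w
        simp only [transpose_apply, of_apply, eq_comm (a := w), hcast w.2 u.2]
      · simp⟩
  refine ⟨A, hLU.symm.trans (luEquiv_graphState A hφ b ?_ hd hb)⟩
  intro i j hij
  by_cases hdim : d i = d j
  · rw [directSum, dif_pos hdim]
    have : (⟨j, rfl⟩ : Block d (d j)) ≠ ⟨i, hdim⟩ := fun e => hij (congrArg Subtype.val e).symm
    simp only [A, of_apply, if_neg this, natCast_zmod_val, neg_neg]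
  · rw [directSum_of_ne A hdim, neg_zero]
    -- a common value of the characters is a root of unity of two coprime orders
    apply injective_stdAddChar
    rw [AddChar.map_zero_eq_one]
    have h1 := hpow (b i j)
    have h2 := hpow (b j i)
    rw [← hsymm i j] at h2
    have hcop : Nat.Coprime (d i) (d j) := (Nat.coprime_primes (hd i) (hd j)).mpr hdim
    have h3 := Nat.dvd_gcd (orderOf_dvd_of_pow_eq_one h2) (orderOf_dvd_of_pow_eq_one h1)
    rw [hcop] at h3
    exact orderOf_eq_one_iff.mp (Nat.dvd_one.mp h3)

end DirectSum

/-! ### Graph states are stabilizer states -/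

section GraphStab

variable [∀ i, NeZero (d i)] (A : BlockAdj d)

/-- The stabilizer element of the graph state with `X`-part `a`: the shift by `a` conjugated by the
diagonal unitary with entries `graphAmp A`. -/
def graphStabilizer (a : Conf d) : Matrix (Conf d) (Conf d) ℂ :=
  Matrix.of fun s t => if s = t + a then graphAmp A s * (graphAmp A t)⁻¹ else 0

theorem graphStabilizer_mul (a b : Conf d) :
    graphStabilizer A a * graphStabilizer A b = graphStabilizer A (a + b) := by
  ext s t
  rw [mul_apply, Finset.sum_eq_single (t + b)]
  · simp only [graphStabilizer, of_apply, if_true, add_assoc, add_comm b a]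
    split_ifs
    · have := graphAmp_ne_zero A (t + b)
      field_simp
    · simp
  · intro u _ hu
    simp [graphStabilizer, hu]
  · simp

theorem graphStabilizer_zero : graphStabilizer A 0 = 1 := by
  ext s t
  simp only [graphStabilizer, of_apply, add_zero, one_apply]
  split_ifs with h
  · rw [h, mul_inv_cancel₀ (graphAmp_ne_zero A t)]
  · rfl

theorem graphStabilizer_conjTranspose (a : Conf d) :
    (graphStabilizer A a)ᴴ = graphStabilizer A (-a) := by
  have hstar : ∀ t, star (graphAmp A t) = (graphAmp A t)⁻¹ := fun t =>
    (Complex.inv_eq_conj (norm_graphAmp A t)).symm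
  ext s t
  simp only [graphStabilizer, conjTranspose_apply, of_apply, apply_ite star, star_zero,
    star_mul', star_inv₀, hstar, inv_inv]
  by_cases h : t = s + a
  · rw [if_pos h, if_pos (by rw [h, add_neg_cancel_right]), mul_comm]
  · rw [if_neg h, if_neg fun h' => h (by rw [h', neg_add_cancel_right])]

theorem graphStabilizer_mem (a : Conf d) :
    graphStabilizer A a ∈ unitaryGroup (Conf d) ℂ := by
  rw [mem_unitaryGroup_iff', star_eq_conjTranspose, graphStabilizer_conjTranspose,
    graphStabilizer_mul, neg_add_cancel, graphStabilizer_zero]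

theorem graphStabilizer_mulVec (a : Conf d) :
    graphStabilizer A a *ᵥ graphState (directSum A) = graphState (directSum A) := by
  have h : graphStabilizer A a *ᵥ graphAmp A = graphAmp A := by
    funext s
    rw [mulVec, dotProduct, Finset.sum_eq_single (s - a)]
    · rw [graphStabilizer, of_apply, if_pos (by simp),
        inv_mul_cancel_right₀ (graphAmp_ne_zero A _)]
    · intro u _ hu
      rw [graphStabilizer, of_apply, if_neg (fun h => hu (by rw [h, add_sub_cancel_right])),
        zero_mul]
    · simp
  rw [graphState_eq, mulVec_smul, h]

theorem eq_zero_of_graphStabilizer_eq_smul {a : Conf d} {c : ℂ}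
    (h : graphStabilizer A a = c • (1 : Matrix (Conf d) (Conf d) ℂ)) : a = 0 ∧ c = 1 := by
  have h1 := congrFun (congrFun h a) 0
  rw [graphStabilizer, of_apply, if_pos (zero_add a).symm] at h1
  have h2 : a = 0 := by
    by_contra ha
    rw [Matrix.smul_apply, one_apply_ne ha, smul_zero] at h1
    exact mul_ne_zero (graphAmp_ne_zero A _) (inv_ne_zero (graphAmp_ne_zero A _)) h1
  subst h2
  rw [mul_inv_cancel₀ (graphAmp_ne_zero A _)] at h1
  simpa using h1.symm

theorem edgePhase_pow (i j : Fin n) (x : ZMod (d i)) (y : ZMod (d j)) :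
    edgePhase A i j x y ^ d i = 1 := by
  rw [edgePhase, ← AddChar.map_nsmul_eq_pow, nsmul_eq_mul, natCast_self, zero_mul,
    AddChar.map_zero_eq_one]

theorem graphStabilizer_mem_pauliGroup (a : Conf d) : graphStabilizer A a ∈ pauliGroup d := by
  -- the phase of the edge `i < j` is attached to the site `i`
  let c : Fin n → ℂ := fun i => ∏ j, if i < j then edgePhase A i j (a i) (a j) else 1
  have hc : ∏ i, c i = graphAmp A a := by
    rw [graphAmp, Finset.prod_filter, ← Finset.univ_product_univ, Finset.prod_product]
  have hpow : ∀ i, c i ^ d i = 1 := by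
    intro i
    rw [← Finset.prod_pow]
    refine Finset.prod_eq_one fun j _ => ?_
    split_ifs
    · exact edgePhase_pow A i j _ _
    · exact one_pow _
  refine ⟨fun i => c i • (pauliX (d i) ^ (a i).val * pauliZ (d i) ^ (neighbour A a i).val),
    fun i => ⟨c i, a i, neighbour A a i, ?_, rfl⟩, ?_⟩
  · split_ifs with h
    · have h2 := hpow i
      rw [h] at h2
      rw [show (4 : ℕ) = 2 * 2 from rfl, pow_mul, h2, one_pow]
    · exact hpow i
  · ext s t
    rw [tensorOp_smul, hc, Matrix.smul_apply]
    simp only [graphStabilizer, tensorOp, of_apply, pauliX_pow_mul_pauliZ_pow_apply, smul_eq_mul]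
    by_cases h : s = t + a
    · have h0 := graphAmp_ne_zero A t
      subst h
      rw [if_pos rfl, graphAmp_add]
      simp only [Pi.add_apply, if_true]
      rw [← pairing]
      field_simp
    · obtain ⟨i, hi⟩ := Function.ne_iff.mp h
      rw [if_neg h, Finset.prod_eq_zero (Finset.mem_univ i) (if_neg hi), mul_zero]

/-- The stabilizer elements of a graph state, as a homomorphism on the group of labels. -/
def graphStabilizerHom : Multiplicative (Conf d) →* unitaryGroup (Conf d) ℂ where
  toFun a := ⟨graphStabilizer A a.toAdd, graphStabilizer_mem A _⟩
  map_one' := Subtype.ext (graphStabilizer_zero A)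
  map_mul' a b := Subtype.ext (graphStabilizer_mul A a.toAdd b.toAdd).symm

theorem graphState_mem_stabStates : graphState (directSum A) ∈ stabStates d := by
  refine ⟨graphState_unit A, (graphStabilizerHom A).range, ⟨?_, ?_, ?_, ?_⟩, ?_⟩
  · rintro _ ⟨a, rfl⟩
    exact graphStabilizer_mem_pauliGroup A _
  · rintro _ ⟨a, rfl⟩ _ ⟨b, rfl⟩
    rw [← map_mul, ← map_mul, mul_comm]
  · rintro _ ⟨a, rfl⟩ c hc
    exact (eq_zero_of_graphStabilizer_eq_smul A hc).2
  · have hinj : Function.Injective (graphStabilizerHom A) := by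
      rw [injective_iff_map_eq_one]
      intro a ha
      have h : graphStabilizer A a.toAdd = (1 : ℂ) • (1 : Matrix (Conf d) (Conf d) ℂ) := by
        rw [one_smul]
        exact congrArg Subtype.val ha
      exact congrArg Multiplicative.ofAdd (eq_zero_of_graphStabilizer_eq_smul A h).1
    rw [← Nat.card_congr (MonoidHom.ofInjective hinj).toEquiv, ← card_conf (d := d)]
    rfl
  · rintro _ ⟨a, rfl⟩
    exact graphStabilizer_mulVec A _

end GraphStab

/-! ### The moves on adjacency matrices are local unitary equivalences -/

section Moves

variable [∀ i, NeZero (d i)]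

/-- The permutation `|x⟩ ↦ |β x⟩` of the basis of one qudit, read on functions as `f ↦ f (β ·)`. -/
def scaleOp {p : ℕ} (β : ZMod p) : Matrix (ZMod p) (ZMod p) ℂ :=
  Matrix.of fun s t => if t = β * s then 1 else 0

theorem scaleOp_mul_weyl {p : ℕ} [Fact p.Prime] {β : ZMod p} (hβ : β ≠ 0) (a b : ZMod p) :
    scaleOp β * weyl a b = weyl (β⁻¹ * a) (β * b) * scaleOp β := by
  ext s t
  rw [mul_weyl_apply, weyl_mul_apply]
  simp only [scaleOp, of_apply, mul_add, mul_inv_cancel_left₀ hβ, sub_eq_iff_eq_add]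
  split_ifs with h
  · rw [h, add_sub_cancel_right, one_mul, mul_one]
    congr 1
    ring
  · simp

theorem scaleOp_isometry {p : ℕ} [Fact p.Prime] {β : ZMod p} (hβ : β ≠ 0) :
    (scaleOp β)ᴴ * scaleOp β = 1 := by
  refine mul_eq_one_comm.mp ?_
  ext s t
  rw [mul_apply, Finset.sum_eq_single (β * s)]
  · simp [scaleOp, conjTranspose_apply, one_apply, hβ]
  · intro u _ hu
    simp [scaleOp, hu]
  · simp

variable (A : BlockAdj d)

/-- Entries of the direct sum after the move `M_{β,v}` in one block. -/
theorem directSum_update_moveM {p : Set.range d} {β : ZMod p} {v : Block d p}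
    {B : Adj (Block d p) p} (hB : B.1 = moveM β v (A p).1) (i j : Fin n) :
    directSum (Function.update A p B) i j =
      (if i = v.1 then (β.val : ZMod (d i)) else 1) * directSum A i j *
        (if j = v.1 then (β.val : ZMod (d i)) else 1) := by
  obtain ⟨p, hp⟩ := p
  obtain ⟨v, hv⟩ := v
  dsimp only at hv β ⊢
  by_cases hij : d j = d i
  · by_cases hi : d i = p
    · subst hi
      have h1 : Function.update A ⟨d i, hp⟩ B ⟨d i, i, rfl⟩ = B := Function.update_self _ _ _
      rw [directSum, dif_pos hij, h1, hB, directSum, dif_pos hij, moveM, mul_diagonal,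
        diagonal_mul, natCast_zmod_val]
      simp only [Function.update_apply, Subtype.mk.injEq, Pi.one_apply]
    · have h1 : Function.update A ⟨p, hp⟩ B ⟨d i, i, rfl⟩ = A ⟨d i, i, rfl⟩ :=
        Function.update_of_ne (fun e => hi (congrArg Subtype.val e)) _ _
      have hi' : i ≠ v := by rintro rfl; exact hi hv
      have hj' : j ≠ v := by rintro rfl; exact hi (hij.symm.trans hv)
      rw [directSum, dif_pos hij, h1, directSum, dif_pos hij, if_neg hi', if_neg hj', one_mul,
        mul_one]
  · rw [directSum_of_ne _ hij, directSum_of_ne _ hij, mul_zero, zero_mul]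

/-- Entries of the direct sum after the move `L_{α,v}` in one block. -/
theorem directSum_update_moveL {p : Set.range d} {α : ZMod p} {v : Block d p}
    {B : Adj (Block d p) p} (hB : B.1 = moveL α v (A p).1) {i j : Fin n} (hne : i ≠ j) :
    directSum (Function.update A p B) i j = directSum A i j +
      (α.val : ZMod (d i)) * directSum A i v.1 * ((directSum A v.1 j).val : ZMod (d i)) := by
  obtain ⟨p, hp⟩ := p
  obtain ⟨v, hv⟩ := v
  dsimp only at hv α ⊢
  by_cases hij : d j = d i
  · by_cases hi : d i = p
    · subst hi
      have h1 : Function.update A ⟨d i, hp⟩ B ⟨d i, i, rfl⟩ = B := Function.update_self _ _ _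
      have h2 := directSum_val_cast A (p := ⟨d i, hp⟩) (i := v) (j := j) hv hij
      dsimp only at h2
      have h3 : (⟨i, rfl⟩ : Block d (d i)) ≠ ⟨j, hij⟩ := fun e => hne (congrArg Subtype.val e)
      rw [directSum, dif_pos hij, h1, hB, h2, directSum, dif_pos hij, directSum, dif_pos hv, moveL,
        of_apply, if_neg h3, natCast_zmod_val, (A ⟨d i, hp⟩).2.1.apply ⟨v, hv⟩ ⟨i, rfl⟩]
    · have h1 : Function.update A ⟨p, hp⟩ B ⟨d i, i, rfl⟩ = A ⟨d i, i, rfl⟩ :=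
        Function.update_of_ne (fun e => hi (congrArg Subtype.val e)) _ _
      rw [directSum_of_ne A (i := i) (j := v) (fun e => hi (e.symm.trans hv)), directSum,
        dif_pos hij, h1, directSum, dif_pos hij]
      simp
  · rw [directSum_of_ne _ hij, directSum_of_ne _ hij]
    by_cases hi : d v = d i
    · rw [directSum_of_ne A (i := v) (j := j) (fun e => hij (e.trans hi))]
      simp
    · rw [directSum_of_ne A hi]
      simp

theorem luEquiv_of_moveM (hd : ∀ i, (d i).Prime) {p : Set.range d} {β : ZMod p} (hβ : β ≠ 0)
    {v : Block d p} {B : Adj (Block d p) p} (hB : B.1 = moveM β v (A p).1) :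
    LUEquiv (graphState (directSum A)) (graphState (directSum (Function.update A p B))) := by
  have hent := directSum_update_moveM A hB
  obtain ⟨p, hp⟩ := p
  obtain ⟨v, hv⟩ := v
  dsimp only at hv
  subst hv
  dsimp only at β hβ hent
  have := fun i => Fact.mk (hd i)
  -- the `v`-th generator is rescaled so that its `X`-part is again `1`
  let b : Fin n → Conf d := fun i => if i = v then β.val • fun j => -directSum A j v
    else Function.update (fun j => -directSum A j i) v (β * -directSum A v i)
  have hLU := LUEquiv.mulVec (siteOp_isometry (scaleOp_isometry hβ)) (graphState (directSum A))
  refine hLU.symm.trans (luEquiv_graphState _ (hLU.unit (graphState_unit A)) b ?_ hd ?_)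
  · intro i j hij
    rw [hent]
    by_cases hi : i = v
    · subst hi
      simp only [b, if_true, if_neg hij.symm, Pi.smul_apply]
      rw [nsmul_eq_mul]
      ring
    · simp only [b, if_neg hi]
      by_cases hj : j = v
      · subst hj
        rw [Function.update_self, if_pos rfl, natCast_zmod_val]
        ring
      · rw [Function.update_of_ne hj, if_neg hj]
        ring
  · intro i
    have h1 := labels_siteOp (i := v) (W := scaleOp β)
      ⟨1, by simp, by rw [one_smul]; exact scaleOp_mul_weyl hβ _ _⟩
      (labels_graphState_single A hd i)
    by_cases hi : i = v
    · subst hi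
      have h2 := AddSubgroup.nsmul_mem _ h1 β.val
      convert h2 using 2
      · funext j
        rcases eq_or_ne j i with rfl | hj
        · rw [Prod.smul_fst, Pi.smul_apply, nsmul_eq_mul, natCast_zmod_val]
          simp [hβ]
        · simp [hj]
      · simp only [b, if_true, directSum_self, neg_zero, mul_zero]
        congr 1
        funext j
        rcases eq_or_ne j i with rfl | hj
        · simp [directSum_self]
        · simp [hj]
    · convert h1 using 2
      · funext j
        rcases eq_or_ne j v with rfl | hj
        · simp [Ne.symm hi]
        · simp [hj]
      · simp only [b, if_neg hi]

theorem luEquiv_of_moveL (hd : ∀ i, (d i).Prime) {p : Set.range d} {α : ZMod p}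
    {v : Block d p} {B : Adj (Block d p) p} (hB : B.1 = moveL α v (A p).1) :
    LUEquiv (graphState (directSum A)) (graphState (directSum (Function.update A p B))) := by
  have hent := fun {i j} => directSum_update_moveL A hB (i := i) (j := j)
  obtain ⟨p, hp⟩ := p
  obtain ⟨v, hv⟩ := v
  dsimp only at hv
  subst hv
  dsimp only at α hent
  obtain ⟨T, hT, hTw⟩ := exists_shear (hd v) α
  -- the shear puts `-α A v i` into the `X`-part of the `i`-th generator at the site `v`;
  -- this multiple of the `v`-th generator removes it
  let k : Fin n → ℕ := fun i => α.val * (directSum A v i).val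
  let b : Fin n → Conf d := fun i => (fun j => -directSum A j i) + k i • fun j => -directSum A j v
  have hLU := LUEquiv.mulVec (siteOp_isometry hT) (graphState (directSum A))
  have hmem : ∀ i, ((Function.update (Pi.single i 1) v
      ((Pi.single i 1 : Conf d) v + α * -directSum A v i) : Conf d), fun j => -directSum A j i) ∈
      labels (tensorOp (siteOp v T) *ᵥ graphState (directSum A)) := by
    intro i
    have h1 := labels_siteOp (hTw _ _) (labels_graphState_single A hd i)
    rwa [Function.update_eq_self v (fun j => -directSum A j i)] at h1
  refine hLU.symm.trans (luEquiv_graphState _ (hLU.unit (graphState_unit A)) b ?_ hd ?_)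
  · intro i j hij
    rw [hent hij.symm]
    simp only [b, k, Pi.add_apply, Pi.smul_apply]
    rw [nsmul_eq_mul, Nat.cast_mul]
    ring
  · intro i
    convert AddSubgroup.add_mem _ (hmem i) (AddSubgroup.nsmul_mem _ (hmem v) (k i)) using 2
    · funext j
      rcases eq_or_ne j v with rfl | hj
      · rw [Prod.fst_add, Prod.smul_fst, Pi.add_apply, Pi.smul_apply, nsmul_eq_mul, Nat.cast_mul,
          natCast_zmod_val, natCast_zmod_val]
        simp [directSum_self]
      · simp [hj]
    · rfl

theorem luEquiv_of_eqvGen (hd : ∀ i, (d i).Prime) (p : Set.range d) {B C : Adj (Block d p) p}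
    (h : Relation.EqvGen Step B C) : ∀ A : BlockAdj d,
      LUEquiv (graphState (directSum (Function.update A p B)))
        (graphState (directSum (Function.update A p C))) := by
  induction h with
  | rel B C h =>
    intro A
    have h1 : Function.update A p B p = B := Function.update_self _ _ _
    have e : Function.update A p C = Function.update (Function.update A p B) p C := by
      rw [Function.update_idem]
    rw [e]
    rcases h with ⟨β, v, hβ, hC⟩ | ⟨α, v, hC⟩
    · exact luEquiv_of_moveM _ hd hβ (by rw [h1]; exact hC)
    · exact luEquiv_of_moveL _ hd (by rw [h1]; exact hC)
  | refl B => exact fun A => LUEquiv.refl _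
  | symm B C _ ih => exact fun A => (ih A).symm
  | trans B C D _ _ ih1 ih2 => exact fun A => (ih1 A).trans (ih2 A)

/-- Blockwise equivalent adjacency matrices have equivalent graph states. -/
theorem luEquiv_of_forall_eqvGen (hd : ∀ i, (d i).Prime) {A B : BlockAdj d}
    (h : ∀ p, Relation.EqvGen Step (A p) (B p)) :
    LUEquiv (graphState (directSum A)) (graphState (directSum B)) := by
  classical
  have hs : ∀ s : Finset (Set.range d),
      LUEquiv (graphState (directSum A)) (graphState (directSum (s.piecewise B A))) := by
    intro s
    induction s using Finset.induction_on with
    | empty => simpa using LUEquiv.refl _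
    | insert p s hp ih =>
      have h1 := luEquiv_of_eqvGen hd p (h p) (s.piecewise B A)
      have e : Function.update (s.piecewise B A) p (A p) = s.piecewise B A := by
        rw [Function.update_eq_self_iff, Finset.piecewise_eq_of_notMem _ _ _ hp]
      rw [e] at h1
      rw [Finset.piecewise_insert]
      convert ih.trans h1
  have := hs Finset.univ
  rwa [Finset.piecewise_univ] at this

end Moves

/-! ### Projective measurements and unitaries of finite order -/

section Spectral

variable {p : ℕ} [NeZero p]

/-- The observable with eigenvalues `ω ^ (-a)` and eigenprojectors `P a`. -/
def phaseSum (P : ZMod p → Matrix (ZMod p) (ZMod p) ℂ) : Matrix (ZMod p) (ZMod p) ℂ :=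
  ∑ a, (stdAddChar (-a) : ℂ) • P a

/-- The projector onto the `ω ^ (-a)`-eigenspace of a unitary of order dividing `p`. -/
def spectralProj (U : Matrix (ZMod p) (ZMod p) ℂ) (a : ZMod p) : Matrix (ZMod p) (ZMod p) ℂ :=
  (p : ℂ)⁻¹ • ∑ k : ZMod p, (stdAddChar (k * a) : ℂ) • U ^ k.val

variable {P : ZMod p → Matrix (ZMod p) (ZMod p) ℂ}
  (hmul : ∀ a a', P a * P a' = if a' = a then P a else 0) (hsum : ∑ a, P a = 1)

include hmul in
theorem sum_smul_mul_sum_smul (f g : ZMod p → ℂ) :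
    (∑ a, f a • P a) * ∑ a, g a • P a = ∑ a, (f a * g a) • P a := by
  rw [Finset.sum_mul]
  refine Finset.sum_congr rfl fun a _ => ?_
  rw [Finset.mul_sum, Finset.sum_eq_single a]
  · rw [smul_mul_smul_comm, hmul, if_pos rfl]
  · intro a' _ ha'
    rw [smul_mul_smul_comm, hmul, if_neg ha', smul_zero]
  · simp

include hmul hsum in
theorem phaseSum_pow (k : ℕ) :
    phaseSum P ^ k = ∑ a, (stdAddChar (-((k : ZMod p) * a)) : ℂ) • P a := by
  induction k with
  | zero => simp [hsum]
  | succ k ih =>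
    rw [pow_succ, ih, phaseSum, sum_smul_mul_sum_smul hmul]
    refine Finset.sum_congr rfl fun a _ => ?_
    rw [← AddChar.map_add_eq_mul]
    congr 2
    push_cast
    ring

include hmul hsum in
theorem phaseSum_pow_self : phaseSum P ^ p = 1 := by
  rw [phaseSum_pow hmul hsum]
  simp [hsum]

include hmul hsum in
theorem phaseSum_isometry (hherm : ∀ a, (P a).IsHermitian) :
    (phaseSum P)ᴴ * phaseSum P = 1 := by
  have h : (phaseSum P)ᴴ = ∑ a, (stdAddChar a : ℂ) • P a := by
    rw [phaseSum, conjTranspose_sum]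
    refine Finset.sum_congr rfl fun a _ => ?_
    rw [conjTranspose_smul, (hherm a).eq, star_stdAddChar, neg_neg]
  rw [h, phaseSum, sum_smul_mul_sum_smul hmul, ← hsum]
  refine Finset.sum_congr rfl fun a _ => ?_
  rw [← AddChar.map_add_eq_mul, add_neg_cancel, AddChar.map_zero_eq_one, one_smul]

include hmul hsum in
theorem spectralProj_phaseSum (a : ZMod p) : spectralProj (phaseSum P) a = P a := by
  have hp : (p : ℂ) ≠ 0 := Nat.cast_ne_zero.mpr (NeZero.ne p)
  simp only [spectralProj, phaseSum_pow hmul hsum, natCast_zmod_val, Finset.smul_sum, smul_smul]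
  rw [Finset.sum_comm, Finset.sum_eq_single a]
  · have h : ∀ k : ZMod p, (p : ℂ)⁻¹ * (stdAddChar (k * a) * stdAddChar (-(k * a))) =
        (p : ℂ)⁻¹ := by
      intro k
      rw [← AddChar.map_add_eq_mul, add_neg_cancel, AddChar.map_zero_eq_one, mul_one]
    rw [Finset.sum_congr rfl fun k _ => by rw [h k], Finset.sum_const, Finset.card_univ, ZMod.card,
      ← Nat.cast_smul_eq_nsmul ℂ, smul_smul, mul_inv_cancel₀ hp, one_smul]
  · intro b _ hb
    have h : ∀ k : ZMod p, (p : ℂ)⁻¹ * (stdAddChar (k * a) * stdAddChar (-(k * b))) =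
        (p : ℂ)⁻¹ * stdAddChar (k * (a - b)) := by
      intro k
      rw [← AddChar.map_add_eq_mul, ← sub_eq_add_neg, mul_sub]
    rw [← Finset.sum_smul, Finset.sum_congr rfl fun k _ => h k, ← Finset.mul_sum,
      sum_stdAddChar_mul, if_neg (sub_ne_zero.mpr hb.symm), mul_zero, zero_smul]
  · simp

variable {U : Matrix (ZMod p) (ZMod p) ℂ} (hU : Uᴴ * U = 1) (hpow : U ^ p = 1)

include hpow in
theorem pow_val_add (k l : ZMod p) : U ^ (k + l).val = U ^ k.val * U ^ l.val := by
  rw [← pow_add, pow_eq_pow_mod (k.val + l.val) hpow, ZMod.val_add]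

include hU hpow in
theorem pow_val_conjTranspose (k : ZMod p) : (U ^ k.val)ᴴ = U ^ (-k).val := by
  have h1 : U ^ k.val * U ^ (-k).val = 1 := by
    rw [← pow_val_add hpow, add_neg_cancel, val_zero, pow_zero]
  have h2 : ∀ m : ℕ, (U ^ m)ᴴ * U ^ m = 1 := by
    intro m
    have hmem : U ∈ unitaryGroup (ZMod p) ℂ := mem_unitaryGroup_iff'.mpr hU
    exact mem_unitaryGroup_iff'.mp (pow_mem hmem m)
  calc (U ^ k.val)ᴴ = (U ^ k.val)ᴴ * (U ^ k.val * U ^ (-k).val) := by rw [h1, Matrix.mul_one]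
    _ = U ^ (-k).val := by rw [← Matrix.mul_assoc, h2, Matrix.one_mul]

include hU hpow in
theorem spectralProj_isHermitian (a : ZMod p) : (spectralProj U a).IsHermitian := by
  rw [IsHermitian, spectralProj, conjTranspose_smul, conjTranspose_sum, star_inv₀, star_natCast]
  congr 1
  rw [← Equiv.sum_comp (Equiv.neg (ZMod p))]
  refine Finset.sum_congr rfl fun k _ => ?_
  rw [conjTranspose_smul, Equiv.neg_apply, pow_val_conjTranspose hU hpow, star_stdAddChar, neg_neg,
    neg_mul, neg_neg]

include hpow in
theorem spectralProj_mul (a a' : ZMod p) :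
    spectralProj U a * spectralProj U a' = if a' = a then spectralProj U a else 0 := by
  have hp : (p : ℂ) ≠ 0 := Nat.cast_ne_zero.mpr (NeZero.ne p)
  have h : (∑ k : ZMod p, (stdAddChar (k * a) : ℂ) • U ^ k.val) *
      ∑ k : ZMod p, (stdAddChar (k * a') : ℂ) • U ^ k.val =
      ∑ m : ZMod p, ((∑ k : ZMod p, (stdAddChar (k * (a - a')) : ℂ)) * stdAddChar (m * a')) •
        U ^ m.val := by
    simp only [Finset.sum_mul, Finset.sum_smul]
    rw [Finset.sum_comm]
    refine Finset.sum_congr rfl fun k _ => ?_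
    rw [Finset.mul_sum]
    conv_rhs => rw [← Equiv.sum_comp (Equiv.addLeft k)]
    refine Finset.sum_congr rfl fun l _ => ?_
    rw [smul_mul_smul_comm, Equiv.coe_addLeft, pow_val_add hpow, ← AddChar.map_add_eq_mul,
      ← AddChar.map_add_eq_mul]
    congr 2
    ring
  rw [spectralProj, spectralProj, smul_mul_smul_comm, h, sum_stdAddChar_mul]
  by_cases haa : a' = a
  · subst haa
    rw [if_pos (sub_self _), if_pos rfl]
    simp only [mul_smul]
    rw [← Finset.smul_sum, inv_smul_smul₀ hp]
  · rw [if_neg (fun h => haa (sub_eq_zero.mp h).symm), if_neg haa]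
    simp

theorem sum_spectralProj (U : Matrix (ZMod p) (ZMod p) ℂ) :
    ∑ a, spectralProj U a = 1 := by
  have hp : (p : ℂ) ≠ 0 := Nat.cast_ne_zero.mpr (NeZero.ne p)
  simp only [spectralProj, ← Finset.smul_sum]
  rw [Finset.sum_comm]
  have h : ∀ k : ZMod p, ∑ a : ZMod p, (stdAddChar (k * a) : ℂ) • U ^ k.val =
      (if k = 0 then (p : ℂ) else 0) • U ^ k.val := by
    intro k
    rw [← Finset.sum_smul, ← sum_stdAddChar_mul]
    simp only [mul_comm k]
  rw [Finset.sum_congr rfl fun k _ => h k]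
  simp [hp]

end Spectral

/-! ### Bell expressions and local unitaries -/

section Bell

variable [∀ i, NeZero (d i)] {m : Fin n → ℕ} (I : Conf d → (∀ i, Fin (m i)) → ℝ)

theorem tensorOp_spectralProj (U : ∀ i, Matrix (ZMod (d i)) (ZMod (d i)) ℂ) (a : Conf d) :
    tensorOp (fun i => spectralProj (U i) (a i)) =
      ∑ k : Conf d, ((∏ i, (d i : ℂ))⁻¹ * ∏ i, stdAddChar (k i * a i)) •
        tensorOp fun i => U i ^ (k i).val := by
  ext s t
  rw [Matrix.sum_apply]
  simp only [tensorOp, spectralProj, of_apply, Matrix.smul_apply, Matrix.sum_apply, smul_eq_mul,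
    Finset.prod_mul_distrib, Finset.prod_univ_sum, Fintype.piFinset_univ, Finset.prod_inv_distrib,
    Finset.mul_sum, mul_assoc]

theorem expect_sum_smul {ι : Type*} (s : Finset ι) (c : ι → ℂ)
    (M : ι → Matrix (Conf d) (Conf d) ℂ) (ψ : Conf d → ℂ) :
    expect d (∑ k ∈ s, c k • M k) ψ = ∑ k ∈ s, c k * expect d (M k) ψ := by
  simp only [expect, sum_mulVec, dotProduct_sum, smul_mulVec, dotProduct_smul, smul_eq_mul]

/-- Fourier inversion: the Bell expression of the spectral measurements of `U` in terms of `U`. -/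
theorem bellMeas_spectralProj (U : ∀ i, Fin (m i) → Matrix (ZMod (d i)) (ZMod (d i)) ℂ)
    (ψ : Conf d → ℂ) :
    bellMeas I (fun i x a => spectralProj (U i x) a) ψ = bellUnitary I U ψ := by
  simp only [bellMeas, bellUnitary, tensorOp_spectralProj, expect_sum_smul, fourierCoeff,
    Finset.mul_sum, Finset.sum_mul]
  rw [Finset.sum_comm]
  conv_rhs => rw [Finset.sum_comm]
  refine Finset.sum_congr rfl fun x _ => ?_
  rw [Finset.sum_comm]
  refine Finset.sum_congr rfl fun k _ => Finset.sum_congr rfl fun a _ => ?_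
  ring

theorem isMeasurement_spectralProj
    {U : ∀ i, Fin (m i) → Matrix (ZMod (d i)) (ZMod (d i)) ℂ} (hU : IsObservable U) :
    IsMeasurement (fun i x a => spectralProj (U i x) a) :=
  ⟨fun i x a => spectralProj_isHermitian (hU.unitary i x) (hU.pow_eq i x) a,
    fun i x a a' => spectralProj_mul (hU.pow_eq i x) a a', fun _ _ => sum_spectralProj _⟩

theorem isObservable_phaseSum
    {M : ∀ i, Fin (m i) → ZMod (d i) → Matrix (ZMod (d i)) (ZMod (d i)) ℂ}
    (hM : IsMeasurement M) : IsObservable (fun i x => phaseSum (M i x)) :=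
  ⟨fun i x => phaseSum_isometry (hM.mul_eq i x) (hM.sum_eq i x) (hM.herm i x),
    fun i x => phaseSum_pow_self (hM.mul_eq i x) (hM.sum_eq i x)⟩

theorem bellUnitary_phaseSum
    {M : ∀ i, Fin (m i) → ZMod (d i) → Matrix (ZMod (d i)) (ZMod (d i)) ℂ}
    (hM : IsMeasurement M) (ψ : Conf d → ℂ) :
    bellUnitary I (fun i x => phaseSum (M i x)) ψ = bellMeas I M ψ := by
  rw [← bellMeas_spectralProj]
  congr 1
  funext i x a
  exact spectralProj_phaseSum (hM.mul_eq i x) (hM.sum_eq i x) a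

theorem expect_im {M : Matrix (Conf d) (Conf d) ℂ} (hM : M.IsHermitian) (ψ : Conf d → ℂ) :
    (expect d M ψ).im = 0 := by
  have h : star (expect d M ψ) = expect d M ψ := by
    rw [expect, ← star_dotProduct_star, star_star, star_mulVec, hM.eq,
      ← dotProduct_mulVec]
  exact Complex.conj_eq_iff_im.mp h

theorem bellMeas_im {M : ∀ i, Fin (m i) → ZMod (d i) → Matrix (ZMod (d i)) (ZMod (d i)) ℂ}
    (hM : IsMeasurement M) (ψ : Conf d → ℂ) : (bellMeas I M ψ).im = 0 := by
  simp only [bellMeas, Complex.im_sum]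
  refine Finset.sum_eq_zero fun a _ => Finset.sum_eq_zero fun x _ => ?_
  have h : (tensorOp fun i => M i (x i) (a i)).IsHermitian := by
    rw [IsHermitian, tensorOp_conjTranspose]
    congr 1
    funext i
    exact hM.herm _ _ _
  rw [Complex.im_ofReal_mul, expect_im h, mul_zero]

theorem bellUnitary_im {U : ∀ i, Fin (m i) → Matrix (ZMod (d i)) (ZMod (d i)) ℂ}
    (hU : IsObservable U) (ψ : Conf d → ℂ) : (bellUnitary I U ψ).im = 0 := by
  rw [← bellMeas_spectralProj]
  exact bellMeas_im I (isMeasurement_spectralProj hU) ψ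

/-- A local unitary can be moved from the state to the observables. -/
theorem bellUnitary_of_luEquiv {ψ φ : Conf d → ℂ} (h : LUEquiv ψ φ)
    {U : ∀ i, Fin (m i) → Matrix (ZMod (d i)) (ZMod (d i)) ℂ} (hU : IsObservable U) :
    ∃ U' : ∀ i, Fin (m i) → Matrix (ZMod (d i)) (ZMod (d i)) ℂ, IsObservable U' ∧
      bellUnitary I U ψ = bellUnitary I U' φ := by
  obtain ⟨V, hV, c, hc, rfl⟩ := h
  have hV' : ∀ i, V i * (V i)ᴴ = 1 := fun i => mul_eq_one_comm.mp (hV i)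
  have hpow : ∀ (i : Fin n) (W : Matrix (ZMod (d i)) (ZMod (d i)) ℂ) (k : ℕ),
      ((V i)ᴴ * W * V i) ^ k = (V i)ᴴ * W ^ k * V i := by
    intro i W k
    induction k with
    | zero => rw [pow_zero, pow_zero, Matrix.mul_one, hV]
    | succ k ih =>
      rw [pow_succ, ih, pow_succ]
      simp only [Matrix.mul_assoc]
      rw [← Matrix.mul_assoc (V i) (V i)ᴴ, hV', Matrix.one_mul]
  refine ⟨fun i x => (V i)ᴴ * U i x * V i, ⟨fun i x => ?_, fun i x => ?_⟩, ?_⟩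
  · simp only [conjTranspose_mul, conjTranspose_conjTranspose, Matrix.mul_assoc]
    rw [← Matrix.mul_assoc (V i) (V i)ᴴ, hV', Matrix.one_mul, ← Matrix.mul_assoc (U i x)ᴴ,
      hU.unitary, Matrix.one_mul, hV]
  · rw [hpow, hU.pow_eq, Matrix.mul_one, hV]
  · simp only [bellUnitary, expect_smul c hc, expect_mulVec, tensorOp_conjTranspose, tensorOp_mul,
      hpow]

/-! ### The maximum is attained -/

theorem isCompact_isObservable :
    IsCompact {U : ∀ i, Fin (m i) → Matrix (ZMod (d i)) (ZMod (d i)) ℂ | IsObservable U} := by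
  have h : {U : ∀ i, Fin (m i) → Matrix (ZMod (d i)) (ZMod (d i)) ℂ | IsObservable U} =
      Set.pi Set.univ fun i => Set.pi Set.univ fun _ =>
        {V : Matrix (ZMod (d i)) (ZMod (d i)) ℂ | Vᴴ * V = 1 ∧ V ^ d i = 1} := by
    ext U
    simp only [Set.mem_ofPred_eq, Set.mem_pi, Set.mem_univ, true_imp_iff]
    exact ⟨fun h i x => ⟨h.unitary i x, h.pow_eq i x⟩,
      fun h => ⟨fun i x => (h i x).1, fun i x => (h i x).2⟩⟩
  rw [h]
  refine isCompact_univ_pi fun i => isCompact_univ_pi fun _ => ?_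
  have hball : IsCompact {V : Matrix (ZMod (d i)) (ZMod (d i)) ℂ |
      ∀ s t, V s t ∈ Metric.closedBall (0 : ℂ) 1} := by
    have := isCompact_univ_pi fun _ : ZMod (d i) => isCompact_univ_pi fun _ : ZMod (d i) =>
      isCompact_closedBall (0 : ℂ) 1
    refine (congrArg IsCompact (Set.ext fun V => ?_)).mp this
    exact ⟨fun hV s t => hV s trivial t trivial, fun hV s _ t _ => hV s t⟩
  refine hball.of_isClosed_subset ?_ ?_
  · exact (isClosed_eq (by fun_prop) continuous_const).inter
      (isClosed_eq (by fun_prop) continuous_const)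
  · rintro V ⟨hV, -⟩ s t
    rw [mem_closedBall_zero_iff]
    exact entry_norm_bound_of_unitary (mem_unitaryGroup_iff'.mpr hV) s t

theorem continuous_bellUnitary (ψ : Conf d → ℂ) :
    Continuous fun U : ∀ i, Fin (m i) → Matrix (ZMod (d i)) (ZMod (d i)) ℂ =>
      bellUnitary I U ψ := by
  have h : ∀ (k : Conf d) (x : ∀ i, Fin (m i)), Continuous
      fun U : ∀ i, Fin (m i) → Matrix (ZMod (d i)) (ZMod (d i)) ℂ =>
        tensorOp fun i => U i (x i) ^ (k i).val := by
    intro k x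
    refine continuous_matrix fun s t => ?_
    simp only [tensorOp, of_apply]
    refine continuous_finsetProd _ fun i _ => ?_
    have h1 : Continuous fun U : ∀ i, Fin (m i) → Matrix (ZMod (d i)) (ZMod (d i)) ℂ =>
        U i (x i) ^ (k i).val := ((continuous_apply (x i)).comp (continuous_apply i)).pow _
    exact h1.matrix_elem _ _
  unfold bellUnitary expect
  refine continuous_finsetSum _ fun k _ => continuous_finsetSum _ fun x _ => ?_
  exact continuous_const.mul
    (continuous_const.dotProduct ((h k x).matrix_mulVec continuous_const))

theorem exists_isMaxValue_bellUnitary (ψ : Conf d → ℂ) :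
    ∃ v : ℝ, IsMaxValue {z | ∃ U : ∀ i, Fin (m i) → Matrix (ZMod (d i)) (ZMod (d i)) ℂ,
      IsObservable U ∧ z = bellUnitary I U ψ} v := by
  obtain ⟨U, hU, hmax⟩ := isCompact_isObservable.exists_isMaxOn
    ⟨fun i (_ : Fin (m i)) => (1 : Matrix (ZMod (d i)) (ZMod (d i)) ℂ), by simp, by simp⟩
    (Complex.continuous_re.comp (continuous_bellUnitary I ψ)).continuousOn
  refine ⟨(bellUnitary I U ψ).re, ⟨U, hU, ?_⟩, ?_⟩
  · exact Complex.ext (by simp) (by simp [bellUnitary_im I hU])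
  · rintro _ ⟨U', hU', rfl⟩
    exact ⟨bellUnitary_im I hU' ψ, hmax hU'⟩

end Bell

end StabScenario

end

open StabScenario in
theorem theorem1 {n : ℕ} (d m : Fin n → ℕ) [∀ i, NeZero (d i)] (hd : ∀ i, (d i).Prime)
    (I : (∀ i, ZMod (d i)) → (∀ i, Fin (m i)) → ℝ) :
    ∃ (v : ℝ) (f : StabScenario.BlockAdj d → ℝ),
      -- `v` is the maximum of the Bell expression over stabilizer states and measurements
      StabScenario.IsMaxValue
        {z | ∃ M ψ, StabScenario.IsMeasurement M ∧ ψ ∈ StabScenario.stabStates d ∧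
          z = StabScenario.bellMeas I M ψ} v ∧
      -- the same value in terms of local unitaries with `U ^ (d i) = 1`
      StabScenario.IsMaxValue
        {z | ∃ U ψ, StabScenario.IsObservable U ∧ ψ ∈ StabScenario.stabStates d ∧
          z = StabScenario.bellUnitary I U ψ} v ∧
      -- `f A` is the maximum over the local unitaries for the graph state of `A`
      (∀ A : StabScenario.BlockAdj d, StabScenario.IsMaxValue
        {z | ∃ U, StabScenario.IsObservable U ∧
          z = StabScenario.bellUnitary I U
            (StabScenario.graphState (StabScenario.directSum A))} (f A)) ∧
      -- for every choice of orbit representatives, `v` is the maximum of `f` over their direct sums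
      ∀ rep : StabScenario.RepChoice d, IsGreatest (f '' StabScenario.repBlocks rep) v := by
  choose f hf using fun A : BlockAdj d =>
    exists_isMaxValue_bellUnitary I (graphState (directSum A))
  have : Nonempty (BlockAdj d) := ⟨fun p => ⟨0, by simp [Matrix.IsSymm], by simp⟩⟩
  have : Finite (BlockAdj d) := by
    have : ∀ p : Set.range d, NeZero (p : ℕ) := by
      rintro ⟨_, i, rfl⟩
      infer_instance
    have : ∀ p : Set.range d, Finite (Adj (Block d p) p) := fun p =>
      inferInstanceAs (Finite {A : Block d p → Block d p → ZMod p // _})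
    infer_instance
  have hle : ∀ {A B : BlockAdj d},
      LUEquiv (graphState (directSum A)) (graphState (directSum B)) → f A ≤ f B := by
    intro A B h
    obtain ⟨U, hU, hz⟩ := (hf A).1
    obtain ⟨U', hU', e⟩ := bellUnitary_of_luEquiv I h hU
    have := ((hf B).2 _ ⟨U', hU', rfl⟩).2
    rwa [← e, ← hz, Complex.ofReal_re] at this
  obtain ⟨A₀, hA₀⟩ := Finite.exists_max f
  have hmax : IsMaxValue {z | ∃ U ψ, IsObservable U ∧ ψ ∈ stabStates d ∧
      z = bellUnitary I U ψ} (f A₀) := by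
    constructor
    · obtain ⟨U, hU, hz⟩ := (hf A₀).1
      exact ⟨U, _, hU, graphState_mem_stabStates A₀, hz⟩
    · rintro _ ⟨U, ψ, hU, hψ, rfl⟩
      obtain ⟨A, hA⟩ := exists_luEquiv_graphState hd hψ
      obtain ⟨U', hU', e⟩ := bellUnitary_of_luEquiv I hA hU
      obtain ⟨him, hre⟩ := (hf A).2 _ ⟨U', hU', rfl⟩
      rw [e]
      exact ⟨him, hre.trans (hA₀ A)⟩
  have hsets : {z | ∃ M ψ, IsMeasurement M ∧ ψ ∈ stabStates d ∧ z = bellMeas I M ψ} =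
      {z | ∃ U ψ, IsObservable U ∧ ψ ∈ stabStates d ∧ z = bellUnitary I U ψ} := by
    ext z
    constructor
    · rintro ⟨M, ψ, hM, hψ, rfl⟩
      exact ⟨_, ψ, isObservable_phaseSum hM, hψ, (bellUnitary_phaseSum I hM ψ).symm⟩
    · rintro ⟨U, ψ, hU, hψ, rfl⟩
      exact ⟨_, ψ, isMeasurement_spectralProj hU, hψ, (bellMeas_spectralProj I U ψ).symm⟩
  refine ⟨f A₀, f, by rw [hsets]; exact hmax, hmax, hf, fun rep => ⟨?_, ?_⟩⟩
  · have hrel : ∀ p, Relation.EqvGen Step (A₀ p)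
        (rep.1 p (Quotient.mk (orbitSetoid (Block d p) p) (A₀ p))) := fun p =>
      (Quotient.exact (rep.2 p (Quotient.mk (orbitSetoid (Block d p) p) (A₀ p)))).symm
    refine ⟨_, ⟨fun p => Quotient.mk (orbitSetoid (Block d p) p) (A₀ p), rfl⟩, ?_⟩
    have h := luEquiv_of_forall_eqvGen hd
      (B := fun p => rep.1 p (Quotient.mk (orbitSetoid (Block d p) p) (A₀ p))) hrel
    exact le_antisymm (hle h.symm) (hle h)
  · rintro _ ⟨A, -, rfl⟩
    exact hA₀ A
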